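/- For \(s\ge 1\) let \(\mathrm{Her}_s(\mathbb C)\) be the real vector space of Hermitian \(s\times s\) matrices. An *operator system* \(\mathcal C=(\mathcal C_s)_{s\ge1}\) on \(\mathbb C^3\) consists of convex cones \(\mathcal C_s\subseteq \mathrm{Her}_s(\mathbb C)^3\), each closed, with nonempty interior and containing no line, such that \(A\in\mathcal C_s\), \(V\in\mathrm{Mat}_{s,t}(\mathbb C)\) imply \(V^*AV=(V^*A_iV)_i\in\mathcal C_t\). It is *over* a cone \(C\subseteq\mathbb R^3\) if \(\mathcal C_1=C\). It is a *free spectrahedron* if there are \(n\), an interior point \(u\) of \(\mathcal C_1\) and \(M_0,M_1,M_2\in\mathrm{Her}_n(\mathbb C)\) with \(\sum_i u_iM_i=I_n\) such that, for all \(s\) and \(A\in \mathrm{Her}_s(\mathbb C)^3\), \(A\in\mathcal C_s\) if and only if \(\sum_i A_i\otimes M_i\ge 0\) (positive semidefinite). It is a *free numerical range* if it contains finitely many elements (of possibly different levels) for which it is the smallest operator system containing them. Containment, union, intersection and interior are understood levelwise. Let \(D=\{a\in\mathbb R^3\mid a_0\ge 0,\ a_1^2+a_2^2\le a_0^2\}\),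 and for \(s\ge 1\) let \[\mathcal C_s(D)^{\rm lrg}=\{A\in\mathrm{Her}_s(\mathbb C)^3\mid (v^*A_0v,v^*A_1v,v^*A_2v)\in D\ \ \forall v\in\mathbb C^s\},\] \[\mathcal C_s(D)^{\rm sml}=\Big\{\sum_{j=1}^n P_j\otimes c_j\ \Big|\ n\ge1,\ c_j\in D,\ P_j\in\mathrm{Her}_s(\mathbb C),\ P_j\ge0\Big\}.\] **Theorem.** (i) The union of all free spectrahedra over \(D\) covers the interior of \(\mathcal C(D)^{\rm lrg}\), and \(\mathcal C(D)^{\rm sml}\) is the intersection of all free numerical ranges over \(D\). (ii) The point \[\left(\begin{pmatrix}1&0\\0&1\end{pmatrix},\begin{pmatrix}0&0\\0&1\end{pmatrix},\begin{pmatrix}0&1/\sqrt2\\1/\sqrt2&0\end{pmatrix}\right)\] belongs to \(\mathcal C_2(D)^{\rm lrg}\) but to no free spectrahedron over \(D\). (iii) There is no finite set \(F\) of free spectrahedra over \(D\) such that every free spectrahedron over \(D\) is contained in a member of \(F\); nor is there such a finite \(F\) for which every free spectrahedron over \(D\) is contained in the levelwise union of the members of \(F\). -/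

import Mathlib

open scoped Matrix ComplexOrder Kronecker

/-- `Her d s` is the real vector space of `d`-tuples of Hermitian `s × s` matrices, with its
Euclidean topology. -/
abbrev Her (d : ℕ) (s : ℕ+) : Type :=
  Fin d → selfAdjoint (Matrix (Fin s) (Fin s) ℂ)

/-- The compression `V* A V = (V* A₁ V, …, V* A_d V)`. -/
noncomputable def compress {d : ℕ} {s t : ℕ+} (V : Matrix (Fin s) (Fin t) ℂ) (A : Her d s) : Her d t :=
  fun i => ⟨Vᴴ * (A i : Matrix (Fin s) (Fin s) ℂ) * V,
    Matrix.isHermitian_conjTranspose_mul_mul V (A i).2⟩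

/-- The canonical identification of `ℝ^d` with the `d`-tuples of Hermitian `1 × 1` matrices. -/
noncomputable def ofVec {d : ℕ} (a : Fin d → ℝ) : Her d 1 :=
  fun i => a i • (1 : selfAdjoint (Matrix (Fin (1 : ℕ+)) (Fin (1 : ℕ+)) ℂ))

/-- An abstract operator system on `ℂ^d`: at each level `s ≥ 1` a convex cone of Hermitian tuples
that is proper (closed, with nonempty interior, containing no line), such that compressions of
elements of the cones lie in the cones again. -/
structure OperatorSystem (d : ℕ) where
  cone : (s : ℕ+) → ConvexCone ℝ (Her d s)
  isClosed : ∀ s, IsClosed (cone s : Set (Her d s))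
  interior_nonempty : ∀ s, (interior (cone s : Set (Her d s))).Nonempty
  salient : ∀ s, (cone s).Salient
  compress_mem : ∀ (s t : ℕ+) (A : Her d s) (V : Matrix (Fin s) (Fin t) ℂ),
    A ∈ cone s → compress V A ∈ cone t

namespace OperatorSystem

/-- Levelwise containment of operator systems. -/
instance (d : ℕ) : LE (OperatorSystem d) :=
  ⟨fun C E => ∀ s : ℕ+, (C.cone s : Set (Her d s)) ⊆ (E.cone s : Set (Her d s))⟩

/-- `C` is an operator system over the cone `K ⊆ ℝ^d`: its cone at level one is `K`. -/
def IsOver {d : ℕ} (C : OperatorSystem d) (K : Set (Fin d → ℝ)) : Prop :=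
  ∀ a : Fin d → ℝ, ofVec a ∈ C.cone 1 ↔ a ∈ K

/-- A free spectrahedron is an operator system with a finite-dimensional realization: there are
an interior point `u` of the cone at level one and Hermitian `n × n` matrices `M₁, …, M_d` with
`u₁ M₁ + ⋯ + u_d M_d = I` such that, at each level, `A` belongs to the system if and only if
`A₁ ⊗ M₁ + ⋯ + A_d ⊗ M_d` is positive semidefinite. -/
def IsFreeSpectrahedron {d : ℕ} (C : OperatorSystem d) : Prop :=
  ∃ u : Fin d → ℝ, ofVec u ∈ interior (C.cone 1 : Set (Her d 1)) ∧
    ∃ (n : ℕ) (M : Fin d → selfAdjoint (Matrix (Fin n) (Fin n) ℂ)),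
      ∑ i, u i • M i = 1 ∧
      ∀ (s : ℕ+) (A : Her d s), A ∈ C.cone s ↔
        (∑ i, (A i : Matrix (Fin s) (Fin s) ℂ) ⊗ₖ
          (M i : Matrix (Fin n) (Fin n) ℂ)).PosSemidef

/-- A free numerical range is a finitely generated operator system: it contains finitely many
elements, of any levels, for which it is the smallest operator system containing them. -/
def IsFreeNumericalRange {d : ℕ} (C : OperatorSystem d) : Prop :=
  ∃ F : Set (Σ s : ℕ+, Her d s), F.Finite ∧ (∀ p ∈ F, p.2 ∈ C.cone p.1) ∧
    ∀ E : OperatorSystem d, (∀ p ∈ F, p.2 ∈ E.cone p.1) → C ≤ E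

end OperatorSystem

/-- The level `s` of the largest operator system over `K`: the tuples `A` of Hermitian `s × s`
matrices with `(v* A₁ v, …, v* A_d v) ∈ K` for all `v ∈ ℂ^s` (these numbers are real). -/
def lrg {d : ℕ} (K : Set (Fin d → ℝ)) (s : ℕ+) : Set (Her d s) :=
  {A | ∀ v : Fin s → ℂ,
    (fun i => (star v ⬝ᵥ ((A i : Matrix (Fin s) (Fin s) ℂ) *ᵥ v)).re) ∈ K}

/-- The level `s` of the smallest operator system over `K`: the finite sums `∑ⱼ Pⱼ ⊗ cⱼ` with
`Pⱼ` positive semidefinite and `cⱼ ∈ K`. -/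
def sml {d : ℕ} (K : Set (Fin d → ℝ)) (s : ℕ+) : Set (Her d s) :=
  {A | ∃ (n : ℕ) (P : Fin n → Matrix (Fin s) (Fin s) ℂ) (c : Fin n → Fin d → ℝ),
    0 < n ∧ (∀ j, (P j).PosSemidef) ∧ (∀ j, c j ∈ K) ∧
      ∀ i, (A i : Matrix (Fin s) (Fin s) ℂ) = ∑ j, c j i • P j}

/-- The standard circular cone in `ℝ³`. -/
def circularCone : Set (Fin 3 → ℝ) :=
  {a | 0 ≤ a 0 ∧ a 1 ^ 2 + a 2 ^ 2 ≤ a 0 ^ 2}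

/-- The real symmetric matrix `[[a, b], [b, c]]`, as a Hermitian matrix. -/
noncomputable def symm2 (a b c : ℝ) : selfAdjoint (Matrix (Fin 2) (Fin 2) ℂ) :=
  ⟨!![(a : ℂ), (b : ℂ); (b : ℂ), (c : ℂ)], Matrix.IsHermitian.ext fun i j => by
    fin_cases i <;> fin_cases j <;> simp⟩

/-- The triple of Hermitian `2 × 2` matrices
`([[1, 0], [0, 1]], [[0, 0], [0, 1]], [[0, 1/√2], [1/√2, 0]])`. -/
noncomputable def circularPoint : Her 3 2 :=
  ![symm2 1 0 1, symm2 0 0 1, symm2 0 (1 / √2) 0]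

/-! Everything in (i) comes from the `n × n` nilpotent Jordan block `S`. Conjugation by diagonal
unitaries rotates `S`, so its numerical range is a disc about the origin, of some radius `c ≤ 1`;
the all-ones vector shows `c ≥ (n - 1)/n`, hence `c` tends to `1` (`exists_jordanForm_radius`). The
rescaled tuple `M = (I, Re S / c, Im S / c)` has the closed unit disc as joint numerical range. By
self-duality of `D`, its pencil defines a free spectrahedron over `D`, and its compressions generate
a free numerical range over `D`.

The unscaled tuple `(I, Re S, Im S)` lies in the smallest system, since `S` is a corner of a cyclic
shift (`jordanTuple_mem_sml`), and elements of the largest and smallest systems pair to positive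
semidefinite matrices. An interior point `B` of the largest system stays in it when `B 0` is shrunk
by `c` close to `1`; pairing with the unscaled tuple then puts `B` in the spectrahedron of `M`.
Dually, shrinking the last two entries by `c` maps the system generated by `M` into the smallest
one, which is closed, so letting `c` tend to `1` gives the intersection statement.

For (ii), positivity of the pencil `Q` at the point forces `ker Q(1,1,0) ⊆ ker M₂`. A limit `w` of
unit kernel vectors `v` of `Q(1, cos θ, sin θ)` as `θ → 0` lies in both kernels. In `w* Q(1, cos θ,
sin θ) v = 0` only `(cos θ - 1) w* M₁ v` survives, so `w* M₁ w = 0` in the limit and then `w* M₀ w =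
0`, although `M₀` is positive definite.

For (iii), a finite union of systems is levelwise closed. If it contained all free spectrahedra over
`D`, it would by (i) contain the closure of the interior of the largest system, hence the point of
(ii). -/

open Topology Filter

/-! ### Quadratic forms of complex matrices. -/

namespace Matrix

variable {n : Type*} [Fintype n]

theorem IsHermitian.posSemidef_iff_re {X : Matrix n n ℂ} (h : X.IsHermitian) :
    X.PosSemidef ↔ ∀ v : n → ℂ, 0 ≤ (star v ⬝ᵥ (X *ᵥ v)).re := by
  refine ⟨fun hX v => hX.re_dotProduct_nonneg v, fun hX => ?_⟩
  refine PosSemidef.of_dotProduct_mulVec_nonneg h fun v => ?_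
  exact Complex.nonneg_iff.2 ⟨hX v, (h.im_star_dotProduct_mulVec_self v).symm⟩

theorem isClosed_setOf_posSemidef : IsClosed {X : Matrix n n ℂ | X.PosSemidef} := by
  have : {X : Matrix n n ℂ | X.PosSemidef} =
      {X | Xᴴ = X} ∩ ⋂ v : n → ℂ, {X | 0 ≤ star v ⬝ᵥ (X *ᵥ v)} := by
    ext X
    simp [posSemidef_iff_dotProduct_mulVec, IsHermitian]
  rw [this]
  refine (isClosed_eq (by fun_prop) (by fun_prop)).inter (isClosed_iInter fun v => ?_)
  exact isClosed_le continuous_const (by fun_prop)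

theorem re_star_dotProduct_self (v : n → ℂ) : (star v ⬝ᵥ v).re = ∑ i, ‖v i‖ ^ 2 := by
  simp [dotProduct, ← Complex.normSq_eq_conj_mul_self, Complex.normSq_eq_norm_sq, -Complex.ofReal_pow]

theorem isCompact_setOf_re_star_dotProduct_self :
    IsCompact {v : n → ℂ | (star v ⬝ᵥ v).re = 1} := by
  refine Metric.isCompact_of_isClosed_isBounded
    (isClosed_eq (by fun_prop) continuous_const) ?_
  refine (Metric.isBounded_closedBall (x := (0 : n → ℂ)) (r := 1)).subset fun v hv => ?_
  rw [Set.mem_ofPred_eq, re_star_dotProduct_self] at hv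
  rw [mem_closedBall_zero_iff, pi_norm_le_iff_of_nonneg zero_le_one]
  intro i
  have : ‖v i‖ ^ 2 ≤ 1 := hv ▸ Finset.single_le_sum (f := fun i => ‖v i‖ ^ 2)
    (fun i _ => sq_nonneg _) (Finset.mem_univ i)
  exact (sq_le_one_iff₀ (norm_nonneg _)).1 this

theorem re_dotProduct_smul_mulVec_smul (X : Matrix n n ℂ) (t : ℝ) (v : n → ℂ) :
    (star (t • v) ⬝ᵥ (X *ᵥ (t • v))).re = t ^ 2 * (star v ⬝ᵥ (X *ᵥ v)).re := by
  rw [star_smul, mulVec_smul, smul_dotProduct, dotProduct_smul]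
  simp [sq, mul_assoc]

/-- The quadratic form of a matrix attains its minimum over the unit sphere. -/
theorem exists_unit_minimizer [Nonempty n] (X : Matrix n n ℂ) :
    ∃ v : n → ℂ, (star v ⬝ᵥ v).re = 1 ∧
      ∀ w, (star v ⬝ᵥ (X *ᵥ v)).re * (star w ⬝ᵥ w).re ≤ (star w ⬝ᵥ (X *ᵥ w)).re := by
  classical
  have hne : {v : n → ℂ | (star v ⬝ᵥ v).re = 1}.Nonempty := by
    refine ⟨Pi.single (Classical.arbitrary n) 1, ?_⟩
    simp
  obtain ⟨v, hv, hmin⟩ := isCompact_setOf_re_star_dotProduct_self.exists_isMinOn hne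
    (f := fun v => (star v ⬝ᵥ (X *ᵥ v)).re) (by fun_prop)
  refine ⟨v, hv, fun w => ?_⟩
  have h0 : 0 ≤ (star w ⬝ᵥ w).re := by
    rw [re_star_dotProduct_self]; positivity
  rcases h0.eq_or_lt with h | h
  · have hw : w = 0 := by
      rw [re_star_dotProduct_self, eq_comm, Finset.sum_eq_zero_iff_of_nonneg (by intros; positivity)] at h
      ext i
      simpa using h i (Finset.mem_univ i)
    simp [hw]
  · set r := (star w ⬝ᵥ w).re
    have key := re_dotProduct_smul_mulVec_smul X (√r)⁻¹ w
    -- The identity matrix turns the same scaling formula into one for the norm.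
    have key1 := re_dotProduct_smul_mulVec_smul (1 : Matrix n n ℂ) (√r)⁻¹ w
    simp only [one_mulVec, inv_pow, Real.sq_sqrt h0] at key key1
    have := hmin (a := (√r)⁻¹ • w) (by
      rw [Set.mem_ofPred_eq, key1]; exact inv_mul_cancel₀ h.ne')
    simp only [Set.mem_ofPred_eq] at this
    rw [key] at this
    calc _ ≤ (r⁻¹ * (star w ⬝ᵥ (X *ᵥ w)).re) * r := by gcongr
      _ = _ := by field_simp

end Matrix

/-! ### Convex hulls of compact sets and closedness of the cones over them. -/

section Caratheodory

variable {E : Type*} [AddCommGroup E] [Module ℝ E] [TopologicalSpace E]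
  [IsTopologicalAddGroup E] [ContinuousSMul ℝ E]

/-- By Carathéodory's theorem at most `finrank + 1` points are needed, so the hull is a finite union
of continuous images of compact sets. -/
theorem IsCompact.isCompact_convexHull [FiniteDimensional ℝ E] {K : Set E} (hK : IsCompact K) :
    IsCompact (convexHull ℝ K) := by
  have : convexHull ℝ K = ⋃ m ∈ Finset.range (Module.finrank ℝ E + 2),
      (fun p : (Fin m → ℝ) × (Fin m → E) => ∑ i, p.1 i • p.2 i) ''
        (stdSimplex ℝ (Fin m) ×ˢ Set.univ.pi fun _ => K) := by
    apply Set.Subset.antisymm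
    · intro x hx
      obtain ⟨ι, _, z, w, hz, hind, hw, hw1, hx⟩ := eq_pos_convex_span_of_mem_convexHull hx
      have hcard : Fintype.card ι ≤ Module.finrank ℝ E + 1 :=
        hind.card_le_finrank_succ.trans (by gcongr; exact Submodule.finrank_le _)
      let e := (Fintype.equivFin ι).symm
      simp only [Set.mem_iUnion]
      refine ⟨Fintype.card ι, Finset.mem_range.2 (by omega), (w ∘ e, z ∘ e), ⟨⟨?_, ?_⟩, ?_⟩, ?_⟩
      · exact fun i => (hw _).le
      · exact (e.sum_comp w).trans hw1
      · exact fun i _ => hz ⟨_, rfl⟩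
      · exact (e.sum_comp fun i => w i • z i).trans hx
    · simp only [Set.iUnion_subset_iff]
      rintro m - _ ⟨⟨w, z⟩, ⟨hw, hz⟩, rfl⟩
      exact (convex_convexHull ℝ K).sum_mem (fun i _ => hw.1 i) hw.2
        fun i _ => subset_convexHull ℝ K (hz i trivial)
  rw [this]
  refine Finset.isCompact_biUnion _ fun m _ => ?_
  exact ((isCompact_stdSimplex ℝ (Fin m)).prod (isCompact_univ_pi fun _ => hK)).image (by fun_prop)

/-- The cone over a compact set contained in an affine hyperplane off the origin is closed. -/
theorem IsCompact.isClosed_pointedConeHull [FiniteDimensional ℝ E] [T2Space E] {K : Set E}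
    (hK : IsCompact K) (f : E →ₗ[ℝ] ℝ) (hf : Continuous f) (hf1 : ∀ x ∈ K, f x = 1) :
    IsClosed (PointedCone.hull ℝ K : Set E) := by
  rcases K.eq_empty_or_nonempty with rfl | hne
  · have h0 : (PointedCone.hull ℝ (∅ : Set E) : Set E) = {0} := by
      simp [PointedCone.hull]
    rw [h0]
    exact isClosed_singleton
  have hf1' : ∀ x ∈ convexHull ℝ K, f x = 1 := fun x hx =>
    convexHull_min (t := f ⁻¹' {1}) hf1 ((convex_singleton 1).linear_preimage f) hx
  have hsub : convexHull ℝ K ⊆ (PointedCone.hull ℝ K : Set E) :=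
    convexHull_min PointedCone.subset_hull (PointedCone.convex _)
  -- Every `x` in the cone is `f x` times a point of the convex hull; recording that point as first
  -- coordinate exhibits the cone as a projection of a closed set along a compact factor.
  have : (PointedCone.hull ℝ K : Set E) = Prod.snd ''
      ({p : E × E | 0 ≤ f p.2 ∧ p.2 = f p.2 • p.1} ∩ (convexHull ℝ K) ×ˢ Set.univ) := by
    ext x
    constructor
    · intro hx
      refine Submodule.span_induction (p := fun x _ => x ∈ Prod.snd ''
        ({p : E × E | 0 ≤ f p.2 ∧ p.2 = f p.2 • p.1} ∩ (convexHull ℝ K) ×ˢ Set.univ))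
        ?_ ?_ ?_ ?_ hx
      · intro x hx
        exact ⟨(x, x), ⟨by simp [hf1 x hx], subset_convexHull ℝ K hx, trivial⟩, rfl⟩
      · obtain ⟨y, hy⟩ := hne
        exact ⟨(y, 0), ⟨by simp, subset_convexHull ℝ K hy, trivial⟩, rfl⟩
      · rintro _ _ - - ⟨⟨a, x⟩, ⟨⟨hx0, hx⟩, ha, -⟩, rfl⟩ ⟨⟨b, y⟩, ⟨⟨hy0, hy⟩, hb, -⟩, rfl⟩
        dsimp only at *
        -- If `f (x + y) = 0`, both summands vanish and any base point serves; otherwise the base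
        -- points are averaged with weights proportional to `f x` and `f y`.
        rcases (add_nonneg hx0 hy0).eq_or_lt with h | h
        · have hx' : f x = 0 := by linarith
          have hy' : f y = 0 := by linarith
          rw [hx', zero_smul] at hx
          rw [hy', zero_smul] at hy
          exact ⟨(a, x + y), ⟨by simp [hx, hy], ha, trivial⟩, rfl⟩
        · refine ⟨((f x / (f x + f y)) • a + (f y / (f x + f y)) • b, x + y), ⟨⟨?_, ?_⟩, ?_, trivial⟩, rfl⟩
          · simpa using h.le
          · simp only [map_add, smul_add, smul_smul, mul_div_cancel₀ _ h.ne']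
            rw [← hx, ← hy]
          · refine convex_convexHull ℝ K ha hb (by positivity) (by positivity) ?_
            rw [← add_div, div_self h.ne']
      · rintro ⟨r, hr⟩ _ - ⟨⟨a, x⟩, ⟨⟨hx0, hx⟩, ha, -⟩, rfl⟩
        dsimp only at *
        refine ⟨(a, r • x), ⟨⟨?_, ?_⟩, ha, trivial⟩, rfl⟩
        · simpa using mul_nonneg hr hx0
        · simp only [map_smul, smul_eq_mul, mul_smul]
          rw [← hx]
    · rintro ⟨⟨a, x⟩, ⟨⟨hx0, hx⟩, ha, -⟩, rfl⟩
      dsimp only at *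
      rw [hx]
      exact (PointedCone.hull ℝ K).smul_mem hx0 (hsub ha)
  have hT : IsClosed {p : E × E | 0 ≤ f p.2 ∧ p.2 = f p.2 • p.1} :=
    IsClosed.inter (s₁ := {p : E × E | 0 ≤ f p.2}) (isClosed_le continuous_const (by fun_prop))
      (isClosed_eq (by fun_prop) (by fun_prop))
  have : (PointedCone.hull ℝ K : Set E) = Prod.snd ''
      ((Prod.map Subtype.val id : convexHull ℝ K × E → E × E) ⁻¹'
        {p : E × E | 0 ≤ f p.2 ∧ p.2 = f p.2 • p.1}) := by
    rw [this]
    ext x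
    simp only [Set.mem_image, Set.mem_inter_iff, Set.mem_prod, Set.mem_preimage]
    constructor
    · rintro ⟨⟨a, y⟩, ⟨h, ha, -⟩, rfl⟩
      exact ⟨(⟨a, ha⟩, y), h, rfl⟩
    · rintro ⟨⟨⟨a, ha⟩, y⟩, h, rfl⟩
      exact ⟨(a, y), ⟨h, ha, trivial⟩, rfl⟩
  rw [this]
  have := isCompact_iff_compactSpace.1 hK.isCompact_convexHull
  exact isClosedMap_snd_of_compactSpace _ (hT.preimage (by fun_prop))
end Caratheodory

/-! ### Topology of the space of Hermitian matrices. -/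

instance {s : ℕ} : ContinuousSMul ℝ (selfAdjoint (Matrix (Fin s) (Fin s) ℂ)) where
  continuous_smul := Continuous.subtype_mk
    (f := fun p : ℝ × selfAdjoint (Matrix (Fin s) (Fin s) ℂ) => p.1 • p.2.1) (by fun_prop) _

instance {s : ℕ} : Module.Finite ℝ (selfAdjoint (Matrix (Fin s) (Fin s) ℂ)) :=
  Module.Finite.of_injective (selfAdjoint.submodule ℝ (Matrix (Fin s) (Fin s) ℂ)).subtype
    Subtype.val_injective

-- A self-adjoint `X` satisfies `-‖X‖ ≤ X` for the operator norm, so every `X` of norm below `t`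
-- qualifies.
open Matrix.Norms.L2Operator MatrixOrder in
theorem eventually_posSemidef_smul_one_add {s : ℕ} {t : ℝ} (ht : 0 < t) :
    ∀ᶠ X in 𝓝 (0 : selfAdjoint (Matrix (Fin s) (Fin s) ℂ)),
      (t • (1 : Matrix (Fin s) (Fin s) ℂ) + X.1).PosSemidef := by
  have : ∀ᶠ X in 𝓝 (0 : selfAdjoint (Matrix (Fin s) (Fin s) ℂ)), ‖X.1‖ < t :=
    ContinuousAt.eventually_lt (by fun_prop) (by fun_prop) (by simpa using ht)
  filter_upwards [this] with X hX
  have h := IsSelfAdjoint.neg_algebraMap_norm_le_self (a := X.1) X.2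
  have h1 : algebraMap ℝ (Matrix (Fin s) (Fin s) ℂ) ‖X.1‖ ≤ algebraMap ℝ _ t :=
    algebraMap_mono _ hX.le
  rw [← Matrix.nonneg_iff_posSemidef, ← Algebra.algebraMap_eq_smul_one]
  exact neg_le_iff_add_nonneg'.1 ((neg_le_neg h1).trans h)

/-! ### Compressions of tuples. -/

section Compress

variable {d : ℕ} {r s t : ℕ+}

/-- The value `(v* A₁ v, …, v* A_d v)` of a tuple at a vector. -/
noncomputable def numVec (v : Fin s → ℂ) (A : Her d s) : Fin d → ℝ :=
  fun i => (star v ⬝ᵥ ((A i).1 *ᵥ v)).re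

theorem mem_lrg {K : Set (Fin d → ℝ)} {A : Her d s} : A ∈ lrg K s ↔ ∀ v, numVec v A ∈ K := Iff.rfl

theorem numVec_add (v : Fin s → ℂ) (A B : Her d s) :
    numVec v (A + B) = numVec v A + numVec v B := by
  ext i
  simp [numVec, Matrix.add_mulVec]

theorem numVec_smul (v : Fin s → ℂ) (c : ℝ) (A : Her d s) :
    numVec v (c • A) = c • numVec v A := by
  ext i
  simp [numVec, Matrix.smul_mulVec]

theorem numVec_neg (v : Fin s → ℂ) (A : Her d s) : numVec v (-A) = -numVec v A := by
  ext i
  simp [numVec, Matrix.neg_mulVec]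

@[simp]
theorem compress_val (V : Matrix (Fin s) (Fin t) ℂ) (A : Her d s) (i : Fin d) :
    (compress V A i).1 = Vᴴ * (A i).1 * V := rfl

theorem compress_compress (V : Matrix (Fin r) (Fin s) ℂ) (W : Matrix (Fin s) (Fin t) ℂ)
    (A : Her d r) : compress W (compress V A) = compress (V * W) A := by
  ext1 i
  apply Subtype.ext
  simp [Matrix.conjTranspose_mul, Matrix.mul_assoc]

theorem compress_one (A : Her d s) : compress (1 : Matrix (Fin s) (Fin s) ℂ) A = A := by
  ext1 i
  apply Subtype.ext
  simp

theorem compress_zero (A : Her d s) : compress (0 : Matrix (Fin s) (Fin t) ℂ) A = 0 := by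
  ext1 i
  apply Subtype.ext
  simp

/-- Compression as a linear map. -/
noncomputable def compressLin (V : Matrix (Fin s) (Fin t) ℂ) : Her d s →ₗ[ℝ] Her d t where
  toFun := compress V
  map_add' A B := by
    ext1 i
    apply Subtype.ext
    simp [Matrix.mul_add, Matrix.add_mul]
  map_smul' c A := by
    ext1 i
    apply Subtype.ext
    simp

theorem compress_smul_left (c : ℝ) (V : Matrix (Fin s) (Fin t) ℂ) (A : Her d s) :
    compress (c • V) A = c ^ 2 • compress V A := by
  ext1 i
  apply Subtype.ext
  simp [sq, mul_smul, Matrix.conjTranspose_smul]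

theorem ofVec_val (a : Fin d → ℝ) (i : Fin d) :
    (ofVec a i).1 = a i • (1 : Matrix (Fin (1 : ℕ+)) (Fin (1 : ℕ+)) ℂ) := rfl

/-- Values of quadratic forms are compressions to level one; this is what ties an operator system to
the largest system over its first level. -/
theorem compress_replicateCol (v : Fin s → ℂ) (A : Her d s) :
    compress (Matrix.replicateCol (Fin (1 : ℕ+)) v) A = ofVec (numVec v A) := by
  ext1 i
  apply Subtype.ext
  have him := (show (A i).1.IsHermitian from (A i).2).im_star_dotProduct_mulVec_self v
  have hre : star v ⬝ᵥ ((A i).1 *ᵥ v) = ((star v ⬝ᵥ ((A i).1 *ᵥ v)).re : ℂ) := by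
    apply Complex.ext
    · simp
    · simpa using him
  ext j k
  have hj : j = 0 := Subsingleton.elim (α := Fin 1) j 0
  have hk : k = 0 := Subsingleton.elim (α := Fin 1) k 0
  subst hj hk
  rw [compress_val, ofVec_val, numVec, Matrix.smul_apply, Matrix.one_apply_eq, Matrix.mul_assoc]
  rw [Complex.real_smul, mul_one, ← hre]
  rfl

theorem numVec_ofVec (v : Fin (1 : ℕ+) → ℂ) (a : Fin d → ℝ) :
    numVec v (ofVec a) = (star v ⬝ᵥ v).re • a := by
  ext i
  rw [numVec, ofVec_val, Matrix.smul_mulVec, Matrix.one_mulVec, dotProduct_smul, Complex.smul_re]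
  exact mul_comm _ _

end Compress

open Matrix.Norms.L2Operator MatrixOrder in
theorem Matrix.PosSemidef.exists_eq_conjTranspose_mul_self {s : ℕ} {P : Matrix (Fin s) (Fin s) ℂ}
    (hP : P.PosSemidef) : ∃ B : Matrix (Fin s) (Fin s) ℂ, P = Bᴴ * B :=
  CStarAlgebra.nonneg_iff_eq_star_mul_self.1 (Matrix.nonneg_iff_posSemidef.2 hP)

/-! ### Cones given by pencils and cones generated by compressions. -/

section Cones

variable {d : ℕ} {r : ℕ+}

/-- The tuples `A` with `A₁ ⊗ M₁ + ⋯ + A_d ⊗ M_d` positive semidefinite. -/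
noncomputable def pencilCone {n : ℕ} (M : Fin d → selfAdjoint (Matrix (Fin n) (Fin n) ℂ)) (s : ℕ+) :
    PointedCone ℝ (Her d s) where
  carrier := {A | (∑ i, (A i).1 ⊗ₖ (M i).1).PosSemidef}
  add_mem' {A B} hA hB := by
    have := Matrix.PosSemidef.add hA hB
    rw [← Finset.sum_add_distrib] at this
    simpa [Matrix.add_kronecker] using this
  zero_mem' := by simpa using Matrix.PosSemidef.zero
  smul_mem' := by
    rintro ⟨c, hc⟩ A hA
    have := Matrix.PosSemidef.smul hA hc
    rw [Finset.smul_sum] at this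
    simpa [Matrix.smul_kronecker] using this

theorem mem_pencilCone {n : ℕ} {M : Fin d → selfAdjoint (Matrix (Fin n) (Fin n) ℂ)} {s : ℕ+}
    {A : Her d s} : A ∈ pencilCone M s ↔ (∑ i, (A i).1 ⊗ₖ (M i).1).PosSemidef := Iff.rfl

theorem isClosed_pencilCone {n : ℕ} (M : Fin d → selfAdjoint (Matrix (Fin n) (Fin n) ℂ)) (s : ℕ+) :
    IsClosed (pencilCone M s : Set (Her d s)) := by
  refine Matrix.isClosed_setOf_posSemidef.preimage
    (f := fun A : Her d s => ∑ i, (A i).1 ⊗ₖ (M i).1) ?_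
  refine continuous_finsetSum _ fun i _ => ?_
  refine continuous_pi fun p => continuous_pi fun q => ?_
  simp only [Matrix.kroneckerMap_apply]
  have : Continuous fun A : Her d s => (A i).1 p.1 q.1 := by
    have h : Continuous fun A : Her d s => (A i).1 := by fun_prop
    exact h.matrix_elem _ _
  exact this.mul continuous_const

/-- Compressing by `V` conjugates the pencil by `V ⊗ I`. -/
theorem compress_mem_pencilCone {n : ℕ} (M : Fin d → selfAdjoint (Matrix (Fin n) (Fin n) ℂ))
    {s t : ℕ+} {A : Her d s} (V : Matrix (Fin s) (Fin t) ℂ) (hA : A ∈ pencilCone M s) :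
    compress V A ∈ pencilCone M t := by
  rw [mem_pencilCone] at *
  convert hA.conjTranspose_mul_mul_same (V ⊗ₖ (1 : Matrix (Fin n) (Fin n) ℂ)) using 1
  rw [Matrix.mul_sum, Matrix.sum_mul]
  refine Finset.sum_congr rfl fun i _ => ?_
  rw [Matrix.conjTranspose_kronecker, ← Matrix.mul_kronecker_mul, ← Matrix.mul_kronecker_mul]
  simp

theorem posSemidef_one_kronecker_iff {n : ℕ} (X : Matrix (Fin n) (Fin n) ℂ) :
    ((1 : Matrix (Fin (1 : ℕ+)) (Fin (1 : ℕ+)) ℂ) ⊗ₖ X).PosSemidef ↔ X.PosSemidef := by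
  constructor
  · intro h
    convert h.submatrix (fun j => ((0 : Fin 1), j)) using 1
    ext i j
    rw [Matrix.submatrix_apply, Matrix.kroneckerMap_apply, Matrix.one_apply_eq, one_mul]
  · intro h
    convert h.submatrix (Prod.snd : Fin (1 : ℕ+) × Fin n → Fin n) using 1
    ext ⟨i, j⟩ ⟨k, l⟩
    have : i = k := Subsingleton.elim (α := Fin 1) i k
    subst this
    rw [Matrix.submatrix_apply, Matrix.kroneckerMap_apply, Matrix.one_apply_eq, one_mul]

theorem posSemidef_sum_ofVec_kronecker_iff {n : ℕ} (M : Fin d → Matrix (Fin n) (Fin n) ℂ)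
    (a : Fin d → ℝ) :
    (∑ i, (ofVec a i).1 ⊗ₖ M i).PosSemidef ↔ (∑ i, a i • M i).PosSemidef := by
  rw [← posSemidef_one_kronecker_iff]
  have : ∑ i, (ofVec a i).1 ⊗ₖ M i =
      (1 : Matrix (Fin (1 : ℕ+)) (Fin (1 : ℕ+)) ℂ) ⊗ₖ (∑ i, a i • M i) := by
    ext p q
    simp only [Matrix.sum_apply, Matrix.kroneckerMap_apply, Finset.mul_sum, ofVec_val,
      Matrix.smul_apply, Complex.real_smul]
    refine Finset.sum_congr rfl fun i _ => ?_
    ring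
  rw [this]

/-- The level `s` of the cones generated by a set of tuples. -/
noncomputable def genCone (G : Set (Her d r)) (s : ℕ+) : PointedCone ℝ (Her d s) :=
  PointedCone.hull ℝ {A | ∃ (V : Matrix (Fin r) (Fin s) ℂ), ∃ P ∈ G, compress V P = A}

theorem compress_mem_genCone_of_mem {G : Set (Her d r)} {P : Her d r} (hP : P ∈ G) {s : ℕ+}
    (V : Matrix (Fin r) (Fin s) ℂ) : compress V P ∈ genCone G s :=
  PointedCone.subset_hull ⟨V, P, hP, rfl⟩

theorem genCone_le {G : Set (Her d r)} {s : ℕ+} {T : PointedCone ℝ (Her d s)}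
    (h : ∀ (V : Matrix (Fin r) (Fin s) ℂ), ∀ P ∈ G, compress V P ∈ T) : genCone G s ≤ T := by
  refine Submodule.span_le.2 ?_
  rintro _ ⟨V, P, hP, rfl⟩
  exact h V P hP

theorem compress_mem_genCone {G : Set (Her d r)} {s t : ℕ+} {A : Her d s}
    (V : Matrix (Fin s) (Fin t) ℂ) (hA : A ∈ genCone G s) : compress V A ∈ genCone G t := by
  suffices h : genCone G s ≤ (genCone G t).comap (compressLin V) from h hA
  refine genCone_le fun W P hP => ?_
  show compress V (compress W P) ∈ genCone G t
  rw [compress_compress]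
  exact compress_mem_genCone_of_mem hP _

/-- The cones generated by a compact set of tuples with first entry the identity are closed. -/
theorem isClosed_genCone {G : Set (Her (d + 1) r)} (hG : IsCompact G) (h1 : ∀ P ∈ G, P 0 = 1)
    (s : ℕ+) : IsClosed (genCone G s : Set (Her (d + 1) s)) := by
  -- Since generators have first entry `I`, this functional takes the value `∑ |V i j|²` on a
  -- compression by `V`. It therefore cuts out a compact base.
  set f : Her (d + 1) s →ₗ[ℝ] ℝ :=
    { toFun := fun A => (A 0).1.trace.re
      map_add' := by simp
      map_smul' := by simp }
  have hf : Continuous f := by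
    show Continuous fun A : Her (d + 1) s => (A 0).1.trace.re
    fun_prop
  set N : Matrix (Fin r) (Fin s) ℂ → ℝ := fun V => ∑ i, ∑ j, ‖V i j‖ ^ 2
  have hfN : ∀ V, ∀ P ∈ G, f (compress V P) = N V := by
    intro V P hP
    show (Vᴴ * (P 0).1 * V).trace.re = _
    rw [h1 P hP]
    rw [selfAdjoint.val_one, Matrix.mul_one]
    simp only [Matrix.trace, Matrix.diag_apply, N, Matrix.mul_apply,
      Matrix.conjTranspose_apply, Complex.re_sum]
    rw [Finset.sum_comm]
    refine Finset.sum_congr rfl fun i _ => Finset.sum_congr rfl fun j _ => ?_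
    simp [← Complex.normSq_eq_norm_sq, Complex.normSq_apply]
  set S : Set (Matrix (Fin r) (Fin s) ℂ) := {V | N V = 1}
  have hS : IsCompact S := by
    refine Metric.isCompact_of_isClosed_isBounded (α := Fin r → Fin s → ℂ)
      (isClosed_eq (by fun_prop) continuous_const) ?_
    refine (Metric.isBounded_closedBall (x := (0 : Fin r → Fin s → ℂ)) (r := 1)).subset fun V hV => ?_
    rw [mem_closedBall_zero_iff, pi_norm_le_iff_of_nonneg zero_le_one]
    intro i
    rw [pi_norm_le_iff_of_nonneg zero_le_one]
    intro j
    have h2 : ‖V i j‖ ^ 2 ≤ 1 := by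
      calc ‖V i j‖ ^ 2 ≤ ∑ j, ‖V i j‖ ^ 2 := Finset.single_le_sum (f := fun j => ‖V i j‖ ^ 2)
            (fun i _ => sq_nonneg _) (Finset.mem_univ j)
        _ ≤ ∑ i, ∑ j, ‖V i j‖ ^ 2 := Finset.single_le_sum (f := fun i => ∑ j, ‖V i j‖ ^ 2)
            (fun i _ => by positivity) (Finset.mem_univ i)
        _ = 1 := hV
    exact (sq_le_one_iff₀ (norm_nonneg _)).1 h2
  set K : Set (Her (d + 1) s) := (fun p : Matrix (Fin r) (Fin s) ℂ × Her (d + 1) r =>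
    compress p.1 p.2) '' (S ×ˢ G)
  have hK : IsCompact K := by
    refine (hS.prod hG).image ?_
    refine continuous_pi fun i => Continuous.subtype_mk ?_ _
    fun_prop
  have hKf : ∀ x ∈ K, f x = 1 := by
    rintro _ ⟨⟨V, P⟩, ⟨hV, hP⟩, rfl⟩
    exact (hfN V P hP).trans hV
  -- Rescaling `V` only scales the compression by a nonnegative factor, so normalized `V` generate
  -- the same cone.
  have : genCone G s = PointedCone.hull ℝ K := by
    apply le_antisymm
    · refine genCone_le fun V P hP => ?_
      have hN0 : 0 ≤ N V := by positivity
      rcases hN0.eq_or_lt with h | h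
      · have : V = 0 := by
          ext i j
          rw [eq_comm, Finset.sum_eq_zero_iff_of_nonneg (by intros; positivity)] at h
          have := h i (Finset.mem_univ i)
          rw [Finset.sum_eq_zero_iff_of_nonneg (by intros; positivity)] at this
          simpa using this j (Finset.mem_univ j)
        rw [this, compress_zero]
        exact Submodule.zero_mem _
      · have hV : compress V P = N V • compress ((√(N V))⁻¹ • V) P := by
          rw [compress_smul_left, smul_smul, inv_pow, Real.sq_sqrt hN0, mul_inv_cancel₀ h.ne',
            one_smul]
        rw [hV]
        refine PointedCone.smul_mem _ hN0 (PointedCone.subset_hull ⟨(_, P), ⟨?_, hP⟩, rfl⟩)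
        rw [Set.mem_ofPred_eq, ← hfN _ P hP, compress_smul_left, map_smul, hfN _ P hP, inv_pow,
          Real.sq_sqrt hN0, smul_eq_mul, inv_mul_cancel₀ h.ne']
    · refine Submodule.span_mono ?_
      rintro _ ⟨⟨V, P⟩, ⟨hV, hP⟩, rfl⟩
      exact ⟨V, P, hP, rfl⟩
  rw [this]
  exact hK.isClosed_pointedConeHull f hf hKf

/-- A compression-stable family of cones contains the smallest system over its first level. -/
theorem sml_subset_of_compress_mem {K : Set (Fin d → ℝ)} (T : ∀ s, PointedCone ℝ (Her d s))
    (hT : ∀ (s t : ℕ+) (A : Her d s) (V : Matrix (Fin s) (Fin t) ℂ), A ∈ T s → compress V A ∈ T t)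
    (hK : ∀ a ∈ K, ofVec a ∈ T 1) (s : ℕ+) : sml K s ⊆ T s := by
  rintro A ⟨n, P, c, -, hP, hc, hA⟩
  choose B hB using fun j => (hP j).exists_eq_conjTranspose_mul_self
  -- With `P j = (B j)ᴴ * B j`, each row of `B j` contributes one rank-one compression of the
  -- level-one element `c j`.
  have : A = ∑ j, ∑ k, compress (Matrix.replicateRow (Fin (1 : ℕ+)) (B j k)) (ofVec (c j)) := by
    ext1 i
    apply Subtype.ext
    rw [hA]
    simp only [Finset.sum_apply, AddSubgroup.val_finsetSum, compress_val, ofVec_val]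
    refine Finset.sum_congr rfl fun j _ => ?_
    simp only [Matrix.mul_smul, Matrix.smul_mul, Matrix.mul_one, ← Finset.smul_sum]
    congr 1
    rw [hB]
    ext k l
    rw [Matrix.sum_apply, Matrix.mul_apply]
    refine Finset.sum_congr rfl fun m _ => ?_
    rw [Matrix.mul_apply]
    exact (Fin.sum_univ_one fun _ => (B j)ᴴ k m * B j m l).symm
  rw [this]
  exact Submodule.sum_mem _ fun j _ => Submodule.sum_mem _ fun k _ => hT _ _ _ _ (hK _ (hc j))

end Cones

/-! ### The circular cone and its self-duality. -/

section CircularCone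

theorem exists_angle (x y : ℝ) :
    ∃ θ : ℝ, x = √(x ^ 2 + y ^ 2) * Real.cos θ ∧ y = √(x ^ 2 + y ^ 2) * Real.sin θ := by
  have h : ‖(⟨x, y⟩ : ℂ)‖ = √(x ^ 2 + y ^ 2) := by
    rw [Complex.norm_eq_sqrt_sq_add_sq]
  refine ⟨Complex.arg ⟨x, y⟩, ?_, ?_⟩
  · rw [← h, Complex.norm_mul_cos_arg]
  · rw [← h, Complex.norm_mul_sin_arg]

theorem cos_sin_mem_circularCone (θ : ℝ) : ![1, Real.cos θ, Real.sin θ] ∈ circularCone := by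
  simp [circularCone, Real.cos_sq_add_sin_sq]

/-- The circular cone is contained in its dual cone. -/
theorem circularCone_pairing_nonneg {a b : Fin 3 → ℝ} (ha : a ∈ circularCone)
    (hb : b ∈ circularCone) : 0 ≤ a 0 * b 0 + a 1 * b 1 + a 2 * b 2 := by
  obtain ⟨ha0, ha⟩ := ha
  obtain ⟨hb0, hb⟩ := hb
  have h : |a 1 * b 1 + a 2 * b 2| ≤ a 0 * b 0 := by
    refine abs_le_of_sq_le_sq ?_ (mul_nonneg ha0 hb0)
    calc (a 1 * b 1 + a 2 * b 2) ^ 2 ≤ (a 1 ^ 2 + a 2 ^ 2) * (b 1 ^ 2 + b 2 ^ 2) := by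
          nlinarith [sq_nonneg (a 1 * b 2 - a 2 * b 1)]
      _ ≤ a 0 ^ 2 * b 0 ^ 2 := by gcongr
      _ = _ := by ring
  linarith [neg_abs_le (a 1 * b 1 + a 2 * b 2)]

/-- Self-duality, tested on extreme rays only: the worst angle points opposite to `(a 1, a 2)`. -/
theorem mem_circularCone_iff {a : Fin 3 → ℝ} :
    a ∈ circularCone ↔ ∀ θ : ℝ, 0 ≤ a 0 + a 1 * Real.cos θ + a 2 * Real.sin θ := by
  constructor
  · intro h θ
    simpa using circularCone_pairing_nonneg h (cos_sin_mem_circularCone θ)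
  · intro h
    obtain ⟨θ, h1, h2⟩ := exists_angle (a 1) (a 2)
    have h3 := h (θ + Real.pi)
    rw [Real.cos_add_pi, Real.sin_add_pi] at h3
    set r := √(a 1 ^ 2 + a 2 ^ 2)
    have h4 : r ≤ a 0 := by
      rw [h1, h2] at h3
      have h4 : r * Real.cos θ * Real.cos θ + r * Real.sin θ * Real.sin θ = r := by
        linear_combination r * Real.cos_sq_add_sin_sq θ
      linarith
    exact ⟨(Real.sqrt_nonneg _).trans h4, (Real.sqrt_le_left ((Real.sqrt_nonneg _).trans h4)).1 h4⟩

theorem add_mem_circularCone {a b : Fin 3 → ℝ} (ha : a ∈ circularCone) (hb : b ∈ circularCone) :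
    a + b ∈ circularCone := by
  rw [mem_circularCone_iff] at *
  intro θ
  have := ha θ
  have := hb θ
  simp only [Pi.add_apply]
  linarith

theorem smul_mem_circularCone {a : Fin 3 → ℝ} {c : ℝ} (hc : 0 ≤ c) (ha : a ∈ circularCone) :
    c • a ∈ circularCone := by
  rw [mem_circularCone_iff] at *
  intro θ
  have := mul_nonneg hc (ha θ)
  simp only [Pi.smul_apply, smul_eq_mul]
  linarith

end CircularCone

/-! ### The largest and the smallest system over the circular cone. -/

section LrgSml

variable {s : ℕ+}

theorem add_mem_lrg_circularCone {A B : Her 3 s} (hA : A ∈ lrg circularCone s)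
    (hB : B ∈ lrg circularCone s) : A + B ∈ lrg circularCone s := fun v => by
  have := add_mem_circularCone (mem_lrg.1 hA v) (mem_lrg.1 hB v)
  rw [← numVec_add] at this
  exact this

theorem smul_mem_lrg_circularCone {A : Her 3 s} {c : ℝ} (hc : 0 ≤ c)
    (hA : A ∈ lrg circularCone s) : c • A ∈ lrg circularCone s := fun v => by
  have := smul_mem_circularCone hc (mem_lrg.1 hA v)
  rw [← numVec_smul] at this
  exact this

open MatrixOrder in
theorem eq_zero_of_numVec_eq_zero {d : ℕ} {A : Her d s} (h : ∀ v, numVec v A = 0) : A = 0 := by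
  ext1 i
  apply Subtype.ext
  have hH : (A i).1.IsHermitian := (A i).2
  have h' : ∀ v, (star v ⬝ᵥ ((A i).1 *ᵥ v)).re = 0 := fun v => congrFun (h v) i
  refine le_antisymm ?_ ?_
  · rw [Matrix.le_iff]
    have hn : ((0 : Her d s) i).1 - (A i).1 = -(A i).1 := by simp
    rw [hn, Matrix.IsHermitian.posSemidef_iff_re hH.neg]
    intro v
    rw [Matrix.neg_mulVec, dotProduct_neg, Complex.neg_re, h', neg_zero]
  · show 0 ≤ (A i).1
    rw [Matrix.nonneg_iff_posSemidef, Matrix.IsHermitian.posSemidef_iff_re hH]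
    exact fun v => (h' v).ge

/-- The circular cone contains no line, so all values `v* A v` vanish. This makes every system
inside the largest one salient. -/
theorem eq_zero_of_mem_lrg_of_neg_mem_lrg {A : Her 3 s} (hA : A ∈ lrg circularCone s)
    (hA' : -A ∈ lrg circularCone s) : A = 0 := by
  refine eq_zero_of_numVec_eq_zero fun v => ?_
  obtain ⟨h0, h1⟩ := mem_lrg.1 hA v
  have h2 := mem_lrg.1 hA' v
  rw [numVec_neg] at h2
  obtain ⟨h2, -⟩ := h2
  have h3 : numVec v A 0 = 0 := le_antisymm (by simpa using h2) h0
  rw [h3] at h1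
  ext i
  fin_cases i
  · exact h3
  · show numVec v A 1 = 0
    nlinarith [sq_nonneg (numVec v A 1), sq_nonneg (numVec v A 2)]
  · show numVec v A 2 = 0
    nlinarith [sq_nonneg (numVec v A 1), sq_nonneg (numVec v A 2)]

/-- Tuples in the largest and the smallest system over the circular cone pair to positive
semidefinite matrices. -/
theorem posSemidef_sum_kronecker_of_mem_lrg_of_mem_sml {t : ℕ+} {B : Her 3 s} {J : Her 3 t}
    (hB : B ∈ lrg circularCone s) (hJ : J ∈ sml circularCone t) :
    (∑ i, (B i).1 ⊗ₖ (J i).1).PosSemidef := by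
  obtain ⟨n, P, c, -, hP, hc, hJ⟩ := hJ
  -- After regrouping, each left factor is `B` paired with a point of `D`, which is positive
  -- semidefinite by self-duality.
  have : ∑ i, (B i).1 ⊗ₖ (J i).1 = ∑ j, (∑ i, c j i • (B i).1) ⊗ₖ P j := by
    simp only [hJ]
    ext p q
    simp only [Matrix.sum_apply, Matrix.kroneckerMap_apply, Matrix.smul_apply, Finset.mul_sum,
      Finset.sum_mul]
    rw [Finset.sum_comm]
    refine Finset.sum_congr rfl fun i _ => Finset.sum_congr rfl fun j _ => ?_
    simp only [Complex.real_smul]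
    ring
  rw [this]
  refine Matrix.posSemidef_sum _ fun j _ => Matrix.PosSemidef.kronecker ?_ (hP j)
  have hH : (∑ i, c j i • (B i).1).IsHermitian := by
    have := (∑ i, c j i • B i).2
    rwa [AddSubgroup.val_finsetSum] at this
  rw [hH.posSemidef_iff_re]
  intro v
  have := circularCone_pairing_nonneg (hc j) (hB v)
  simpa [Fin.sum_univ_three, Matrix.add_mulVec, Matrix.smul_mulVec] using this

/-- The order unit `(I, 0, 0)`. -/
noncomputable def unitTuple (s : ℕ+) : Her 3 s := ![1, 0, 0]

theorem unitTuple_eq_ofVec : unitTuple 1 = ofVec ![1, 0, 0] := by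
  ext1 i
  fin_cases i
  · exact (one_smul _ _).symm
  · exact (zero_smul _ _).symm
  · exact (zero_smul _ _).symm

theorem sml_circularCone_mem_nhds (s : ℕ+) : sml circularCone s ∈ 𝓝 (unitTuple s) := by
  have h0 : Tendsto (fun A : Her 3 s => A 0 - 1) (𝓝 (unitTuple s)) (𝓝 0) := by
    have : Continuous fun A : Her 3 s => A 0 - 1 := by fun_prop
    simpa [unitTuple] using this.tendsto (unitTuple s)
  have h1 : Tendsto (fun A : Her 3 s => A 1) (𝓝 (unitTuple s)) (𝓝 0) := by
    have : Continuous fun A : Her 3 s => A 1 := by fun_prop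
    simpa [unitTuple] using this.tendsto (unitTuple s)
  have h2 : Tendsto (fun A : Her 3 s => A 2) (𝓝 (unitTuple s)) (𝓝 0) := by
    have : Continuous fun A : Her 3 s => A 2 := by fun_prop
    simpa [unitTuple] using this.tendsto (unitTuple s)
  have hp := eventually_posSemidef_smul_one_add (s := s) (t := 1 / 4) (by norm_num)
  have hn := neg_zero (G := selfAdjoint (Matrix (Fin s) (Fin s) ℂ))
  have h1' := h1.neg
  have h2' := h2.neg
  rw [hn] at h1' h2'
  filter_upwards [h0.eventually hp, h1.eventually hp, h1'.eventually hp, h2.eventually hp,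
    h2'.eventually hp] with A a0 a1 a1' a2 a2'
  have hhalf : (0 : ℝ) ≤ 1 / 2 := by norm_num
  -- The pairs at `(1, ±1, 0)` and `(1, 0, ±1)` produce `A 1` and `A 2` and use up `I / 2` of the
  -- first entry; the remainder `A 0 - I / 2` sits at `(1, 0, 0)`.
  refine ⟨5, ![(1 / 4 : ℝ) • 1 + (A 0 - 1).1 + (1 / 4 : ℝ) • 1, (1 / 2 : ℝ) • ((1 / 4 : ℝ) • 1 + (A 1).1),
    (1 / 2 : ℝ) • ((1 / 4 : ℝ) • 1 + (-A 1).1), (1 / 2 : ℝ) • ((1 / 4 : ℝ) • 1 + (A 2).1),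
    (1 / 2 : ℝ) • ((1 / 4 : ℝ) • 1 + (-A 2).1)],
    ![![1, 0, 0], ![1, 1, 0], ![1, -1, 0], ![1, 0, 1], ![1, 0, -1]], by norm_num, ?_, ?_, ?_⟩
  · intro j
    fin_cases j
    · exact a0.add (Matrix.PosSemidef.one.smul (by norm_num))
    · exact a1.smul hhalf
    · exact a1'.smul hhalf
    · exact a2.smul hhalf
    · exact a2'.smul hhalf
  · intro j
    fin_cases j <;> simp [circularCone]
  · intro i
    fin_cases i
    all_goals
      ext k l
      simp [Fin.sum_univ_succ]
      try ring

end LrgSml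

/-! ### Operator systems over the circular cone. -/

section System

/-- A closed compression-stable family of pointed cones whose first level is the circular cone. -/
structure IsCircularFamily (T : ∀ s, PointedCone ℝ (Her 3 s)) : Prop where
  isClosed : ∀ s, IsClosed (T s : Set (Her 3 s))
  compress_mem : ∀ (s t : ℕ+) (A : Her 3 s) (V : Matrix (Fin s) (Fin t) ℂ),
    A ∈ T s → compress V A ∈ T t
  ofVec_mem : ∀ a, ofVec a ∈ T 1 ↔ a ∈ circularCone

variable {T : ∀ s, PointedCone ℝ (Her 3 s)}

theorem IsCircularFamily.sml_subset (hT : IsCircularFamily T) (s : ℕ+) :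
    sml circularCone s ⊆ T s :=
  sml_subset_of_compress_mem T hT.compress_mem (fun a => (hT.ofVec_mem a).2) s

theorem IsCircularFamily.mem_lrg (hT : IsCircularFamily T) {s : ℕ+} {A : Her 3 s} (hA : A ∈ T s) :
    A ∈ lrg circularCone s := fun v =>
  (hT.ofVec_mem _).1 (compress_replicateCol v A ▸ hT.compress_mem _ _ _ _ hA)

theorem IsCircularFamily.unitTuple_mem_interior (hT : IsCircularFamily T) (s : ℕ+) :
    unitTuple s ∈ interior (T s : Set (Her 3 s)) :=
  mem_interior_iff_mem_nhds.2 (mem_of_superset (sml_circularCone_mem_nhds s) (hT.sml_subset s))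

/-- The operator system over the circular cone given by a suitable family of cones. -/
noncomputable def IsCircularFamily.system (hT : IsCircularFamily T) : OperatorSystem 3 where
  cone s := (T s).toConvexCone
  isClosed := hT.isClosed
  interior_nonempty s := ⟨_, hT.unitTuple_mem_interior s⟩
  salient _ _ hA hA0 hA' := hA0 <|
    eq_zero_of_mem_lrg_of_neg_mem_lrg (hT.mem_lrg hA) (hT.mem_lrg hA')
  compress_mem := hT.compress_mem

theorem IsCircularFamily.mem_system (hT : IsCircularFamily T) {s : ℕ+} {A : Her 3 s} :
    A ∈ hT.system.cone s ↔ A ∈ T s := Iff.rfl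

theorem IsCircularFamily.system_isOver (hT : IsCircularFamily T) :
    hT.system.IsOver circularCone := hT.ofVec_mem

namespace OperatorSystem

variable {d : ℕ}

theorem zero_mem (C : OperatorSystem d) (s : ℕ+) : (0 : Her d s) ∈ C.cone s := by
  obtain ⟨A, hA⟩ := C.interior_nonempty s
  rw [← compress_zero A]
  exact C.compress_mem _ _ _ _ (interior_subset hA)

/-- The cones of an operator system, as pointed cones. -/
noncomputable def pointedCone (C : OperatorSystem d) (s : ℕ+) : PointedCone ℝ (Her d s) :=
  (C.cone s).toPointedCone (C.zero_mem s)

theorem IsOver.sml_subset {C : OperatorSystem d} {K : Set (Fin d → ℝ)} (hC : C.IsOver K) (s : ℕ+) :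
    sml K s ⊆ C.cone s :=
  sml_subset_of_compress_mem C.pointedCone C.compress_mem (fun a => (hC a).2) s

end OperatorSystem

end System

/-! ### Numerical range and dilation of the Jordan block. -/

section JordanBlock

/-- The nilpotent Jordan block, with ones below the diagonal. -/
def jordanBlock (n : ℕ) : Matrix (Fin n) (Fin n) ℂ :=
  Matrix.of fun j k => if (j : ℕ) = k + 1 then 1 else 0

theorem jordanBlock_apply {n : ℕ} (j k : Fin n) :
    jordanBlock n j k = if (j : ℕ) = k + 1 then 1 else 0 := rfl

/-- The value `v* S v` at the Jordan block `S`. -/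
noncomputable def jordanForm {n : ℕ} (v : Fin n → ℂ) : ℂ := star v ⬝ᵥ (jordanBlock n *ᵥ v)

/-- Multiplication by powers of a point of the unit circle. -/
noncomputable def rotate {n : ℕ} (θ : ℝ) (v : Fin n → ℂ) : Fin n → ℂ :=
  fun k => Complex.exp (-(θ * (k : ℕ)) * Complex.I) * v k

theorem star_dotProduct_rotate {n : ℕ} (θ : ℝ) (v : Fin n → ℂ) :
    (star (rotate θ v) ⬝ᵥ rotate θ v).re = (star v ⬝ᵥ v).re := by
  rw [Matrix.re_star_dotProduct_self, Matrix.re_star_dotProduct_self]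
  refine Finset.sum_congr rfl fun k _ => ?_
  have h : Complex.exp (-(θ * (k : ℕ)) * Complex.I) =
      Complex.exp (((-(θ * (k : ℕ)) : ℝ) : ℂ) * Complex.I) := by push_cast; rfl
  rw [rotate, norm_mul, h, Complex.norm_exp_ofReal_mul_I, one_mul]

/-- Only index pairs `j = k + 1` contribute, and each picks up the phase `exp (iθ(j - k))`. -/
theorem jordanForm_rotate {n : ℕ} (θ : ℝ) (v : Fin n → ℂ) :
    jordanForm (rotate θ v) = Complex.exp (θ * Complex.I) * jordanForm v := by
  simp only [jordanForm, dotProduct, Matrix.mulVec, Finset.mul_sum, jordanBlock_apply]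
  refine Finset.sum_congr rfl fun j _ => Finset.sum_congr rfl fun k _ => ?_
  split_ifs with h
  · simp only [Pi.star_apply, rotate, star_mul', RCLike.star_def, ← Complex.exp_conj, h]
    have : Complex.exp (θ * Complex.I) = Complex.exp ((starRingEnd ℂ)
        (-(θ * ((k + 1 : ℕ) : ℂ)) * Complex.I)) * Complex.exp (-(θ * (k : ℕ)) * Complex.I) := by
      rw [← Complex.exp_add]
      congr 1
      simp
      ring
    rw [this]
    ring
  · simp

/-- The all-ones vector has squared norm `n + 1`, so this bounds the numerical radius below by `n /
(n + 1)`. -/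
theorem re_jordanForm_one (n : ℕ) : (jordanForm (1 : Fin (n + 1) → ℂ)).re = n := by
  have : jordanForm (1 : Fin (n + 1) → ℂ) = n := by
    have h : ∀ i : Fin n, ∑ k : Fin (n + 1), (if ((i.succ : Fin (n + 1)) : ℕ) = k + 1 then (1 : ℂ) else 0) = 1 := by
      intro i
      rw [Finset.sum_eq_single i.castSucc]
      · simp
      · intro k _ hk
        rw [if_neg]
        intro h
        exact hk (Fin.ext (by simpa using h.symm))
      · simp
    simp only [jordanForm, dotProduct, Matrix.mulVec, jordanBlock_apply, Pi.one_apply, mul_one,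
      star_one, one_mul]
    rw [Fin.sum_univ_succ, Finset.sum_congr rfl fun i _ => h i]
    simp
  rw [this, Complex.natCast_re]

/-- The numerical range of a Jordan block is a disc centered at the origin. -/
theorem exists_jordanForm_radius (n : ℕ) : ∃ c : ℝ, n ≤ c * (n + 1) ∧
    (∀ v : Fin (n + 1) → ℂ, ‖jordanForm v‖ ≤ c * (star v ⬝ᵥ v).re) ∧
    ∀ θ : ℝ, ∃ v : Fin (n + 1) → ℂ, (star v ⬝ᵥ v).re = 1 ∧
      jordanForm v = c * Complex.exp (θ * Complex.I) := by
  obtain ⟨v₀, h1, hmin⟩ := Matrix.exists_unit_minimizer (-jordanBlock (n + 1))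
  have hmax : ∀ w : Fin (n + 1) → ℂ,
      (jordanForm w).re ≤ (jordanForm v₀).re * (star w ⬝ᵥ w).re := by
    intro w
    have := hmin w
    simp only [Matrix.neg_mulVec, dotProduct_neg, Complex.neg_re] at this
    unfold jordanForm
    linarith
  have hnorm : ∀ w : Fin (n + 1) → ℂ, ‖jordanForm w‖ ≤ (jordanForm v₀).re * (star w ⬝ᵥ w).re := by
    intro w
    -- Rotating the value onto the positive real axis turns the bound on real parts into one on
    -- absolute values.
    have := hmax (rotate (-(jordanForm w).arg) w)
    rw [star_dotProduct_rotate, jordanForm_rotate] at this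
    have h2 : Complex.exp (((-(jordanForm w).arg : ℝ) : ℂ) * Complex.I) * jordanForm w =
        ‖jordanForm w‖ := by
      nth_rewrite 2 [← Complex.norm_mul_exp_arg_mul_I (jordanForm w)]
      rw [mul_left_comm, ← Complex.exp_add]
      simp
    rwa [h2, Complex.ofReal_re] at this
  have hv₀ : jordanForm v₀ = (jordanForm v₀).re := by
    have h2 := hnorm v₀
    rw [h1, mul_one] at h2
    have h3 : (jordanForm v₀).re = ‖jordanForm v₀‖ := le_antisymm (Complex.re_le_norm _) h2
    have h4 := Complex.sq_norm (jordanForm v₀)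
    rw [← h3, Complex.normSq_apply] at h4
    have h5 : (jordanForm v₀).im = 0 := by nlinarith
    apply Complex.ext <;> simp [h5]
  refine ⟨(jordanForm v₀).re, ?_, hnorm, fun θ => ⟨rotate θ v₀, ?_, ?_⟩⟩
  · have := hmax 1
    rw [re_jordanForm_one, Matrix.re_star_dotProduct_self] at this
    simpa using this
  · rw [star_dotProduct_rotate, h1]
  · rw [jordanForm_rotate, ← hv₀, mul_comm]

/-- The tuple `(I, c Re S, c Im S)` for the Jordan block `S`. -/
noncomputable def jordanTuple (c : ℝ) (n : ℕ) :
    Fin 3 → selfAdjoint (Matrix (Fin n) (Fin n) ℂ) :=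
  ![1, c • ⟨(1 / 2 : ℂ) • (jordanBlock n + (jordanBlock n)ᴴ), by
      rw [selfAdjoint.mem_iff, Matrix.star_eq_conjTranspose, Matrix.conjTranspose_smul,
        Matrix.conjTranspose_add, Matrix.conjTranspose_conjTranspose, add_comm]
      simp⟩,
    c • ⟨(-Complex.I / 2) • (jordanBlock n - (jordanBlock n)ᴴ), by
      rw [selfAdjoint.mem_iff, Matrix.star_eq_conjTranspose, Matrix.conjTranspose_smul,
        Matrix.conjTranspose_sub, Matrix.conjTranspose_conjTranspose, ← neg_sub, smul_neg,
        ← neg_smul]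
      congr 1
      simp [neg_div]⟩]

theorem star_dotProduct_conjTranspose_jordanBlock {n : ℕ} (v : Fin n → ℂ) :
    star v ⬝ᵥ ((jordanBlock n)ᴴ *ᵥ v) = star (jordanForm v) := by
  rw [jordanForm, Matrix.star_dotProduct, Matrix.star_mulVec, Matrix.conjTranspose_conjTranspose,
    Matrix.dotProduct_mulVec]

theorem jordanTuple_one_val (c : ℝ) (n : ℕ) : (jordanTuple c n 1).1 =
    c • (1 / 2 : ℂ) • (jordanBlock n + (jordanBlock n)ᴴ) := rfl

theorem jordanTuple_two_val (c : ℝ) (n : ℕ) : (jordanTuple c n 2).1 =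
    c • (-Complex.I / 2) • (jordanBlock n - (jordanBlock n)ᴴ) := rfl

theorem numVec_jordanTuple (c : ℝ) (n : ℕ+) (v : Fin n → ℂ) :
    numVec v (jordanTuple c n) =
      ![(star v ⬝ᵥ v).re, c * (jordanForm v).re, c * (jordanForm v).im] := by
  ext i
  fin_cases i
  · simp [numVec, jordanTuple]
  · show (star v ⬝ᵥ ((jordanTuple c n 1).1 *ᵥ v)).re = c * (jordanForm v).re
    rw [jordanTuple_one_val, Matrix.smul_mulVec, Matrix.smul_mulVec, Matrix.add_mulVec,
      dotProduct_smul, dotProduct_smul, dotProduct_add, star_dotProduct_conjTranspose_jordanBlock,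
      ← jordanForm]
    simp
    left
    ring
  · show (star v ⬝ᵥ ((jordanTuple c n 2).1 *ᵥ v)).re = c * (jordanForm v).im
    rw [jordanTuple_two_val, Matrix.smul_mulVec, Matrix.smul_mulVec, Matrix.sub_mulVec,
      dotProduct_smul, dotProduct_smul, dotProduct_sub, star_dotProduct_conjTranspose_jordanBlock,
      ← jordanForm]
    simp
    ring

theorem sum_rootsOfUnity_zpow {ζ : ℂ} {L : ℕ} (hζ : IsPrimitiveRoot ζ L) {e : ℤ}
    (he : |e| < L) : ∑ m : Fin L, (ζ ^ (m : ℕ)) ^ e = if e = 0 then (L : ℂ) else 0 := by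
  split_ifs with h
  · simp [h]
  · have h1 : ζ ^ e ≠ 1 := by
      rw [Ne, hζ.zpow_eq_one_iff_dvd]
      exact fun hd => h (Int.eq_zero_of_abs_lt_dvd hd he)
    have h2 : (ζ ^ e) ^ L = 1 := by
      rw [← zpow_natCast, zpow_comm, zpow_natCast, hζ.pow_eq_one, one_zpow]
    have h3 : ∀ m : Fin L, (ζ ^ (m : ℕ)) ^ e = (ζ ^ e) ^ (m : ℕ) := fun m => by
      rw [← zpow_natCast, ← zpow_natCast, zpow_comm]
    simp only [h3]
    rw [Fin.sum_univ_eq_sum_range (fun m => (ζ ^ e) ^ m), geom_sum_eq h1, h2, sub_self, zero_div]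

/-- The truncated shift dilates to a unitary diagonalizable shift. -/
theorem jordanTuple_mem_sml (n : ℕ+) : jordanTuple 1 n ∈ sml circularCone n := by
  -- A cyclic shift of order `n + 1` has `S` as its compression to the first `n` coordinates: the
  -- exponents `j - k ± 1` stay below `L` in absolute value, so no wrap-around entry is seen.
  set L : ℕ := n + 1
  have hL : 0 < L := Nat.succ_pos _
  have hL0 : (L : ℂ) ≠ 0 := by exact_mod_cast hL.ne'
  set ζ : ℂ := Complex.exp (2 * Real.pi * Complex.I / L)
  have hζ : IsPrimitiveRoot ζ L := Complex.isPrimitiveRoot_exp L hL.ne'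
  have hζ1 : ∀ m : ℕ, ‖ζ ^ m‖ = 1 := fun m => by
    rw [norm_pow, hζ.norm'_eq_one hL.ne', one_pow]
  have hζ0 : ∀ m : ℕ, ζ ^ m ≠ 0 := fun m => pow_ne_zero _ (hζ.ne_zero hL.ne')
  have hconj : ∀ m : ℕ, (starRingEnd ℂ) (ζ ^ m) = (ζ ^ m)⁻¹ := fun m =>
    (Complex.inv_eq_conj (hζ1 m)).symm
  have hsum : ∀ e : ℤ, |e| < L →
      ∑ m : Fin L, (L : ℂ)⁻¹ * (ζ ^ (m : ℕ)) ^ e = if e = 0 then 1 else 0 := by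
    intro e he
    rw [← Finset.mul_sum, sum_rootsOfUnity_zpow hζ he]
    split_ifs <;> simp [hL0]
  -- Truncated Fourier vectors: eigenvectors of the cyclic shift, with eigenvalue `(ζ ^ m)⁻¹`, cut
  -- down to `n` coordinates.
  let x : Fin L → Fin n → ℂ := fun m j => (ζ ^ (m : ℕ)) ^ (j : ℕ)
  refine ⟨L, fun m => (L : ℝ)⁻¹ • Matrix.vecMulVec (x m) (star (x m)),
    fun m => ![1, ((ζ ^ (m : ℕ))⁻¹).re, ((ζ ^ (m : ℕ))⁻¹).im], hL, ?_, ?_, ?_⟩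
  · exact fun m => (Matrix.posSemidef_vecMulVec_self_star _).smul (by positivity)
  · intro m
    refine ⟨by simp, ?_⟩
    have h2 := Complex.sq_norm ((ζ ^ (m : ℕ))⁻¹)
    rw [norm_inv, hζ1, Complex.normSq_apply] at h2
    simp only [Matrix.cons_val_one, Matrix.cons_val_zero, Matrix.cons_val]
    linarith
  · have hx : ∀ (m : Fin L) (j k : Fin n), x m j * star (x m k) = (ζ ^ (m : ℕ)) ^ ((j : ℤ) - k) := by
      intro m j k
      simp only [x, RCLike.star_def]
      rw [map_pow, hconj, zpow_sub₀ (hζ0 m), zpow_natCast, zpow_natCast, inv_pow]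
      rfl
    have hre : ∀ m : ℕ, ((((ζ ^ m)⁻¹).re : ℝ) : ℂ) = 1 / 2 * ((ζ ^ m)⁻¹ + ζ ^ m) := by
      intro m
      rw [Complex.re_eq_add_conj, ← hconj, Complex.conj_conj]
      ring
    have him : ∀ m : ℕ, ((((ζ ^ m)⁻¹).im : ℝ) : ℂ) = -Complex.I / 2 * ((ζ ^ m)⁻¹ - ζ ^ m) := by
      intro m
      rw [Complex.im_eq_sub_conj, ← hconj, Complex.conj_conj]
      field_simp
      rw [Complex.I_sq]
      ring
    have hb : ∀ (j k : Fin n) (e : ℤ), |e| ≤ 1 → |(j : ℤ) - k + e| < L := by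
      intro j k e he
      have := j.2
      have := k.2
      rw [abs_le] at he
      rw [abs_lt]
      omega
    intro i
    ext j k
    simp only [Matrix.sum_apply, Matrix.smul_apply, Matrix.vecMulVec_apply, Pi.star_apply, hx,
      Complex.real_smul, Complex.ofReal_inv, Complex.ofReal_natCast]
    have h0 := hsum ((j : ℤ) - k) (by simpa using hb j k 0 (by simp))
    have h1 := hsum ((j : ℤ) - k + 1) (hb j k 1 (by simp))
    have h2 := hsum ((j : ℤ) - k + -1) (hb j k (-1) (by simp))
    have hS : jordanBlock n j k = if (j : ℤ) - k + -1 = 0 then 1 else 0 := by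
      rw [jordanBlock_apply]
      congr 1
      rw [eq_iff_iff]
      omega
    have hS' : star (jordanBlock n k j) = if (j : ℤ) - k + 1 = 0 then 1 else 0 := by
      rw [jordanBlock_apply, apply_ite star, star_one, star_zero]
      congr 1
      rw [eq_iff_iff]
      omega
    fin_cases i
    · simp only [jordanTuple]
      simp
      rw [h0, Matrix.one_apply]
      simp [sub_eq_zero, Fin.ext_iff]
    · have : ∀ m : Fin L, (((ζ ^ (m : ℕ))⁻¹).re : ℂ) * ((L : ℂ)⁻¹ * (ζ ^ (m : ℕ)) ^ ((j : ℤ) - k)) =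
          1 / 2 * ((L : ℂ)⁻¹ * (ζ ^ (m : ℕ)) ^ ((j : ℤ) - k + -1) +
            (L : ℂ)⁻¹ * (ζ ^ (m : ℕ)) ^ ((j : ℤ) - k + 1)) := by
        intro m
        rw [hre, zpow_add₀ (hζ0 m), zpow_add₀ (hζ0 m), zpow_neg, zpow_one]
        ring
      show (jordanTuple 1 n 1).1 j k = ∑ m : Fin L, (((ζ ^ (m : ℕ))⁻¹).re : ℂ) *
        ((L : ℂ)⁻¹ * (ζ ^ (m : ℕ)) ^ ((j : ℤ) - k))
      rw [Finset.sum_congr rfl fun m _ => this m, ← Finset.mul_sum, Finset.sum_add_distrib, h1, h2,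
        jordanTuple_one_val, one_smul, Matrix.smul_apply, Matrix.add_apply,
        Matrix.conjTranspose_apply, hS, hS']
      rfl
    · have : ∀ m : Fin L, (((ζ ^ (m : ℕ))⁻¹).im : ℂ) * ((L : ℂ)⁻¹ * (ζ ^ (m : ℕ)) ^ ((j : ℤ) - k)) =
          -Complex.I / 2 * ((L : ℂ)⁻¹ * (ζ ^ (m : ℕ)) ^ ((j : ℤ) - k + -1) -
            (L : ℂ)⁻¹ * (ζ ^ (m : ℕ)) ^ ((j : ℤ) - k + 1)) := by
        intro m
        rw [him, zpow_add₀ (hζ0 m), zpow_add₀ (hζ0 m), zpow_neg, zpow_one]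
        ring
      show (jordanTuple 1 n 2).1 j k = ∑ m : Fin L, (((ζ ^ (m : ℕ))⁻¹).im : ℂ) *
        ((L : ℂ)⁻¹ * (ζ ^ (m : ℕ)) ^ ((j : ℤ) - k))
      rw [Finset.sum_congr rfl fun m _ => this m, ← Finset.mul_sum, Finset.sum_sub_distrib, h1, h2,
        jordanTuple_two_val, one_smul, Matrix.smul_apply, Matrix.sub_apply,
        Matrix.conjTranspose_apply, hS, hS']
      rfl

end JordanBlock

/-! ### Closedness of the smallest system over the circular cone. -/

section Closed

theorem isClosed_circularCone : IsClosed circularCone := by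
  have h : circularCone =
      {a : Fin 3 → ℝ | 0 ≤ a 0} ∩ {a : Fin 3 → ℝ | a 1 ^ 2 + a 2 ^ 2 ≤ a 0 ^ 2} := by
    ext
    exact Iff.rfl
  rw [h]
  exact (isClosed_le (by fun_prop) (by fun_prop)).inter (isClosed_le (by fun_prop) (by fun_prop))

/-- `ofVec` as a linear map. -/
noncomputable def ofVecLin (d : ℕ) : (Fin d → ℝ) →ₗ[ℝ] Her d 1 where
  toFun := ofVec
  map_add' a b := funext fun i => add_smul (a i) (b i) _
  map_smul' c a := funext fun i => mul_smul c (a i) _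

theorem continuous_ofVec {d : ℕ} : Continuous (ofVec (d := d)) :=
  continuous_pi fun i => (continuous_apply i).smul continuous_const

/-- The base of the circular cone. -/
def circularBase : Set (Her 3 1) := ofVec '' {a ∈ circularCone | a 0 = 1}

theorem isCompact_circularBase : IsCompact circularBase := by
  refine IsCompact.image ?_ continuous_ofVec
  refine Metric.isCompact_of_isClosed_isBounded (isClosed_circularCone.inter
    (isClosed_eq (f := fun a : Fin 3 → ℝ => a 0) (by fun_prop) (by fun_prop))) ?_
  refine (Metric.isBounded_closedBall (x := (0 : Fin 3 → ℝ)) (r := 1)).subset ?_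
  rintro a ⟨⟨-, ha⟩, ha1 : a 0 = 1⟩
  rw [mem_closedBall_zero_iff, pi_norm_le_iff_of_nonneg zero_le_one]
  rw [ha1] at ha
  intro i
  rw [Real.norm_eq_abs, abs_le_one_iff_mul_self_le_one]
  fin_cases i
  · simp [ha1]
  · show a 1 * a 1 ≤ 1
    nlinarith [sq_nonneg (a 2)]
  · show a 2 * a 2 ≤ 1
    nlinarith [sq_nonneg (a 1)]

theorem circularBase_zero : ∀ P ∈ circularBase, P 0 = 1 := by
  rintro _ ⟨a, ⟨-, ha⟩, rfl⟩
  rw [ofVec, ha, one_smul]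

/-- The level `s` of the smallest system over `K`, as a pointed cone. -/
noncomputable def smlCone {d : ℕ} (K : Set (Fin d → ℝ)) (hK : K.Nonempty) (s : ℕ+) :
    PointedCone ℝ (Her d s) where
  carrier := sml K s
  add_mem' := by
    rintro A B ⟨n, P, c, hn, hP, hc, hA⟩ ⟨m, Q, e, hm, hQ, he, hB⟩
    refine ⟨n + m, Fin.append P Q, Fin.append c e, by omega, ?_, ?_, ?_⟩
    · intro j
      refine Fin.addCases (fun j => ?_) (fun j => ?_) j
      · simpa using hP j
      · simpa using hQ j
    · intro j
      refine Fin.addCases (fun j => ?_) (fun j => ?_) j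
      · simpa using hc j
      · simpa using he j
    · intro i
      rw [Fin.sum_univ_add]
      simp [hA, hB]
  zero_mem' := by
    obtain ⟨a, ha⟩ := hK
    exact ⟨1, fun _ => 0, fun _ => a, one_pos, fun _ => Matrix.PosSemidef.zero, fun _ => ha,
      fun i => by simp⟩
  smul_mem' := by
    rintro ⟨r, hr⟩ A ⟨n, P, c, hn, hP, hc, hA⟩
    refine ⟨n, fun j => r • P j, c, hn, fun j => (hP j).smul hr, hc, fun i => ?_⟩
    show r • (A i).1 = _
    rw [hA, Finset.smul_sum]
    exact Finset.sum_congr rfl fun j _ => smul_comm _ _ _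

theorem compress_ofVec_mem_sml {d : ℕ} {K : Set (Fin d → ℝ)} {a : Fin d → ℝ} (ha : a ∈ K) {s : ℕ+}
    (V : Matrix (Fin (1 : ℕ+)) (Fin s) ℂ) : compress V (ofVec a) ∈ sml K s := by
  refine ⟨1, fun _ => Vᴴ * V, fun _ => a, one_pos,
    fun _ => Matrix.posSemidef_conjTranspose_mul_self V, fun _ => ha, fun i => ?_⟩
  rw [compress_val, ofVec_val, Matrix.mul_smul, Matrix.mul_one, Matrix.smul_mul,
    Fin.sum_univ_one]

/-- Presents the smallest system as generated by a compact set with first entry `I`, so that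
`isClosed_genCone` applies. -/
theorem sml_circularCone_eq (s : ℕ+) : sml circularCone s = genCone circularBase s := by
  apply Set.Subset.antisymm
  · refine sml_subset_of_compress_mem (genCone circularBase)
      (fun _ _ _ V hA => compress_mem_genCone V hA) (fun a ha => ?_) s
    rcases ha.1.eq_or_lt with h0 | h0
    · have h := ha.2
      rw [← h0] at h
      have : a = 0 := by
        ext i
        fin_cases i
        · exact h0.symm
        · show a 1 = 0
          nlinarith [sq_nonneg (a 1), sq_nonneg (a 2)]
        · show a 2 = 0
          nlinarith [sq_nonneg (a 1), sq_nonneg (a 2)]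
      rw [this]
      have h0 : ofVec 0 = 0 := map_zero (ofVecLin 3)
      rw [h0]
      exact Submodule.zero_mem _
    · have : ofVec a = a 0 • ofVec ((a 0)⁻¹ • a) := by
        have h := map_smul (ofVecLin 3) (a 0) ((a 0)⁻¹ • a)
        rw [smul_smul, mul_inv_cancel₀ h0.ne', one_smul] at h
        exact h
      have hmem : ofVec ((a 0)⁻¹ • a) ∈ circularBase :=
        ⟨_, ⟨smul_mem_circularCone (inv_nonneg.2 h0.le) ha, by simp [h0.ne']⟩, rfl⟩
      rw [this, ← compress_one (ofVec _)]
      exact PointedCone.smul_mem _ h0.le (compress_mem_genCone_of_mem hmem _)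
  · refine genCone_le (T := smlCone circularCone ⟨_, cos_sin_mem_circularCone 0⟩ s) ?_
    rintro V _ ⟨a, ⟨ha, -⟩, rfl⟩
    exact compress_ofVec_mem_sml ha V

theorem isClosed_sml_circularCone (s : ℕ+) : IsClosed (sml circularCone s) := by
  rw [sml_circularCone_eq]
  exact isClosed_genCone isCompact_circularBase circularBase_zero s

end Closed

/-! ### Systems defined by tuples with circular numerical range. -/

section CircularTuple

variable {r s t : ℕ+}

/-- A tuple with first entry the identity whose joint numerical range is a circular disc, up to
convex hulls. -/
structure IsCircularTuple (M : Her 3 r) : Prop where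
  zero_eq : M 0 = 1
  mem_lrg : M ∈ lrg circularCone r
  exists_numVec : ∀ θ : ℝ, ∃ v, numVec v M = ![1, Real.cos θ, Real.sin θ]

theorem numVec_compress {d : ℕ} (V : Matrix (Fin s) (Fin t) ℂ) (A : Her d s) (v : Fin t → ℂ) :
    numVec v (compress V A) = numVec (V *ᵥ v) A := by
  ext i
  rw [numVec, numVec, compress_val, Matrix.mul_assoc, ← Matrix.mulVec_mulVec,
    Matrix.dotProduct_mulVec, ← Matrix.star_mulVec, ← Matrix.mulVec_mulVec]

/-- At level one the pencil tests `a` against the values `v* M v`. These lie in `D` and include all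
extreme rays of `D`, so self-duality gives `D` back. -/
theorem isCircularFamily_pencilCone {M : Her 3 r} (hM : IsCircularTuple M) :
    IsCircularFamily (pencilCone M) where
  isClosed := isClosed_pencilCone M
  compress_mem _ _ _ V hA := compress_mem_pencilCone M V hA
  ofVec_mem a := by
    have hH : (∑ i, a i • (M i).1).IsHermitian := by
      have := (∑ i, a i • M i).2
      rwa [AddSubgroup.val_finsetSum] at this
    have hv : ∀ v, (star v ⬝ᵥ ((∑ i, a i • (M i).1) *ᵥ v)).re =
        a 0 * numVec v M 0 + a 1 * numVec v M 1 + a 2 * numVec v M 2 := fun v => by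
      simp [numVec, Fin.sum_univ_three, Matrix.add_mulVec, Matrix.smul_mulVec]
    rw [mem_pencilCone, posSemidef_sum_ofVec_kronecker_iff, hH.posSemidef_iff_re]
    simp only [hv]
    constructor
    · intro h
      rw [mem_circularCone_iff]
      intro θ
      obtain ⟨v, hv⟩ := hM.exists_numVec θ
      have := h v
      simpa [hv] using this
    · exact fun ha v => circularCone_pairing_nonneg ha (hM.mem_lrg v)

theorem isFreeSpectrahedron_pencilCone {M : Her 3 r} (hM : IsCircularTuple M) :
    (isCircularFamily_pencilCone hM).system.IsFreeSpectrahedron := by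
  refine ⟨![1, 0, 0], ?_, r, M, ?_, fun s A => Iff.rfl⟩
  · rw [← unitTuple_eq_ofVec]
    exact (isCircularFamily_pencilCone hM).unitTuple_mem_interior 1
  · simp [Fin.sum_univ_three, hM.zero_eq]

/-- The level `s` of the largest system over the circular cone, as a pointed cone. -/
noncomputable def lrgCircularCone (s : ℕ+) : PointedCone ℝ (Her 3 s) where
  carrier := lrg circularCone s
  add_mem' := add_mem_lrg_circularCone
  zero_mem' v := by simp [circularCone]
  smul_mem' c _ hA := smul_mem_lrg_circularCone c.2 hA

theorem mem_of_ofVec_mem_lrg {d : ℕ} {K : Set (Fin d → ℝ)} {a : Fin d → ℝ}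
    (ha : ofVec a ∈ lrg K 1) : a ∈ K := by
  have h := mem_lrg.1 ha fun _ => 1
  have h1 : (star (fun _ : Fin (1 : ℕ+) => (1 : ℂ)) ⬝ᵥ fun _ => 1).re = 1 := by
    rw [Matrix.re_star_dotProduct_self]
    simp
    rfl
  rwa [numVec_ofVec, h1, one_smul] at h

theorem isCircularFamily_genCone {M : Her 3 r} (hM : IsCircularTuple M) :
    IsCircularFamily (genCone {M}) where
  isClosed := isClosed_genCone isCompact_singleton (by simpa using hM.zero_eq)
  compress_mem _ _ _ V hA := compress_mem_genCone V hA
  ofVec_mem a := by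
    constructor
    · intro ha
      have h : genCone {M} 1 ≤ lrgCircularCone 1 := by
        refine genCone_le ?_
        rintro V _ rfl v
        have := mem_lrg.1 hM.mem_lrg (V *ᵥ v)
        rw [← numVec_compress] at this
        exact this
      exact mem_of_ofVec_mem_lrg (h ha)
    · intro ha
      have hcirc : ∀ θ : ℝ, ofVec ![1, Real.cos θ, Real.sin θ] ∈ genCone {M} 1 := by
        intro θ
        obtain ⟨v, hv⟩ := hM.exists_numVec θ
        rw [← hv, ← compress_replicateCol]
        exact compress_mem_genCone_of_mem (Set.mem_singleton M) _
      obtain ⟨θ, h1, h2⟩ := exists_angle (a 1) (a 2)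
      have h3 : √(a 1 ^ 2 + a 2 ^ 2) ≤ a 0 := Real.sqrt_le_left ha.1 |>.2 ha.2
      set ρ := √(a 1 ^ 2 + a 2 ^ 2)
      have hρ : 0 ≤ ρ := Real.sqrt_nonneg _
      -- A point of `D` is a nonnegative combination of two antipodal extreme rays; `ρ ≤ a 0` makes
      -- the second weight nonnegative.
      have ha' : a = ((a 0 + ρ) / 2) • ![1, Real.cos θ, Real.sin θ] +
          ((a 0 - ρ) / 2) • ![1, Real.cos (θ + Real.pi), Real.sin (θ + Real.pi)] := by
        rw [Real.cos_add_pi, Real.sin_add_pi]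
        ext i
        fin_cases i
        · simp
          ring
        · simp
          linear_combination h1
        · simp
          linear_combination h2
      have : ofVec a = ((a 0 + ρ) / 2) • ofVec ![1, Real.cos θ, Real.sin θ] +
          ((a 0 - ρ) / 2) • ofVec ![1, Real.cos (θ + Real.pi), Real.sin (θ + Real.pi)] := by
        have h := congrArg (ofVecLin 3) ha'
        rw [map_add, map_smul, map_smul] at h
        exact h
      rw [this]
      exact Submodule.add_mem _ (PointedCone.smul_mem _ (by linarith) (hcirc θ))
        (PointedCone.smul_mem _ (by linarith) (hcirc _))

theorem isFreeNumericalRange_genCone {M : Her 3 r} (hM : IsCircularTuple M) :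
    (isCircularFamily_genCone hM).system.IsFreeNumericalRange := by
  refine ⟨{⟨r, M⟩}, Set.finite_singleton _, ?_, ?_⟩
  · rintro _ rfl
    show M ∈ genCone {M} r
    have := compress_mem_genCone_of_mem (G := {M}) (Set.mem_singleton M) (1 : Matrix (Fin r) (Fin r) ℂ)
    rwa [compress_one] at this
  · intro E hE s
    have h : genCone {M} s ≤ E.pointedCone s := by
      refine genCone_le ?_
      rintro V _ rfl
      exact E.compress_mem _ _ _ V (hE _ rfl)
    exact h

theorem sml_subset_lrg_of_isCircularTuple {M : Her 3 r} (hM : IsCircularTuple M) (s : ℕ+) :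
    sml circularCone s ⊆ lrg circularCone s := fun _ hA =>
  (isCircularFamily_genCone hM).mem_lrg ((isCircularFamily_genCone hM).sml_subset s hA)

/-- Suitably scaled Jordan blocks have circular numerical range, with scaling factors close
to `1`. -/
theorem exists_isCircularTuple_jordanTuple {ε : ℝ} (hε : 0 < ε) :
    ∃ (n : ℕ+) (c : ℝ), 1 - ε < c ∧ 0 < c ∧ c ≤ 1 ∧ IsCircularTuple (jordanTuple c⁻¹ n) := by
  obtain ⟨m, hm⟩ := exists_nat_gt (ε⁻¹)
  have hm0 : (0 : ℝ) < m := (inv_pos.2 hε).trans hm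
  obtain ⟨c, hc, hle, hex⟩ : ∃ c : ℝ, m ≤ c * (m + 1) ∧
      (∀ v : Fin m.succPNat → ℂ, ‖jordanForm v‖ ≤ c * (star v ⬝ᵥ v).re) ∧
      ∀ θ : ℝ, ∃ v : Fin m.succPNat → ℂ, (star v ⬝ᵥ v).re = 1 ∧
        jordanForm v = c * Complex.exp (θ * Complex.I) := exists_jordanForm_radius m
  have hc0 : 0 < c := by
    by_contra! h
    nlinarith
  have hM : IsCircularTuple (r := m.succPNat) (jordanTuple c⁻¹ m.succPNat) := by
    refine ⟨rfl, fun v => ?_, fun θ => ?_⟩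
    · show numVec v (jordanTuple c⁻¹ m.succPNat) ∈ circularCone
      rw [numVec_jordanTuple]
      have h : 0 ≤ (star v ⬝ᵥ v).re := by
        rw [Matrix.re_star_dotProduct_self]
        positivity
      refine ⟨h, ?_⟩
      have h1 := hle v
      rw [← inv_mul_le_iff₀ hc0] at h1
      have h2 := Complex.sq_norm (jordanForm v)
      rw [Complex.normSq_apply] at h2
      calc _ = (c⁻¹ * ‖jordanForm v‖) ^ 2 := by
            rw [mul_pow, h2]
            simp
            ring
        _ ≤ _ := by
            simp only [Matrix.cons_val_zero]
            exact pow_le_pow_left₀ (by positivity) h1 2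
    · obtain ⟨v, hv, hv'⟩ := hex θ
      refine ⟨v, ?_⟩
      rw [numVec_jordanTuple]
      rw [hv, hv', Complex.re_ofReal_mul, Complex.im_ofReal_mul, Complex.exp_ofReal_mul_I_re,
        Complex.exp_ofReal_mul_I_im, inv_mul_cancel_left₀ hc0.ne', inv_mul_cancel_left₀ hc0.ne']
  refine ⟨m.succPNat, c, ?_, hc0, ?_, hM⟩
  · have h1 : 1 < ε * m := by
      rwa [inv_lt_iff_one_lt_mul₀' hε] at hm
    by_contra! h
    nlinarith
  -- The unscaled tuple lies in the largest system; evaluating it at an extremal vector gives `c ≤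
  -- 1`.
  · obtain ⟨v, hv, hv'⟩ := hex 0
    have h := sml_subset_lrg_of_isCircularTuple hM _ (jordanTuple_mem_sml m.succPNat)
    have h1 := mem_lrg.1 h v
    rw [numVec_jordanTuple] at h1
    have h2 := h1.2
    rw [hv, hv'] at h2
    simp at h2
    exact (le_abs_self c).trans h2

end CircularTuple

/-! ### Approximation of the largest and smallest systems by Jordan blocks. -/

section Approximation

variable {s t : ℕ+}

/-- Scaling of all entries but the first. -/
noncomputable def scaleTail (c : ℝ) : Her 3 s →ₗ[ℝ] Her 3 s where
  toFun A := ![A 0, c • A 1, c • A 2]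
  map_add' A B := by
    ext1 i
    fin_cases i <;> simp
  map_smul' r A := by
    ext1 i
    fin_cases i
    · rfl
    · exact smul_comm c r (A 1)
    · exact smul_comm c r (A 2)

theorem scaleTail_one (A : Her 3 s) : scaleTail 1 A = A := by
  ext1 i
  fin_cases i
  · rfl
  · exact one_smul ℝ (A 1)
  · exact one_smul ℝ (A 2)

theorem scaleTail_compress (c : ℝ) (V : Matrix (Fin s) (Fin t) ℂ) (A : Her 3 s) :
    scaleTail c (compress V A) = compress V (scaleTail c A) := by
  ext1 i
  fin_cases i
  · rfl
  · exact congrFun (map_smul (compressLin V) c A) 1 |>.symm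
  · exact congrFun (map_smul (compressLin V) c A) 2 |>.symm

theorem scaleTail_jordanTuple {c : ℝ} (hc : c ≠ 0) (n : ℕ+) :
    scaleTail c (jordanTuple c⁻¹ n) = jordanTuple 1 n := by
  ext1 i
  fin_cases i
  · rfl
  · exact (smul_inv_smul₀ hc _).trans (one_smul ℝ _).symm
  · exact (smul_inv_smul₀ hc _).trans (one_smul ℝ _).symm

/-- Every interior point of the largest system lies in a free spectrahedron. -/
theorem exists_freeSpectrahedron_of_mem_interior_lrg {B : Her 3 s}
    (hB : B ∈ interior (lrg circularCone s)) :
    ∃ S : OperatorSystem 3, S.IsFreeSpectrahedron ∧ S.IsOver circularCone ∧ B ∈ S.cone s := by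
  have hBl := interior_subset hB
  have hB0 : (![B 0, 0, 0] : Her 3 s) ∈ lrg circularCone s := by
    intro v
    have h := (mem_lrg.1 hBl v).1
    exact ⟨h, by simpa using sq_nonneg _⟩
  have hcont : Tendsto (fun δ : ℝ => B - δ • (![B 0, 0, 0] : Her 3 s)) (𝓝 0) (𝓝 B) := by
    have : Continuous fun δ : ℝ => B - δ • (![B 0, 0, 0] : Her 3 s) := by fun_prop
    simpa using this.tendsto 0
  have hev : ∀ᶠ δ : ℝ in 𝓝[>] 0, B - δ • (![B 0, 0, 0] : Her 3 s) ∈ lrg circularCone s :=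
    (hcont.eventually (mem_interior_iff_mem_nhds.1 hB)).filter_mono nhdsWithin_le_nhds
  obtain ⟨δ, hδ, hδ0⟩ := (hev.and self_mem_nhdsWithin).exists
  obtain ⟨n, c, hc, hc0, -, hM⟩ := exists_isCircularTuple_jordanTuple hδ0
  refine ⟨_, isFreeSpectrahedron_pencilCone hM, (isCircularFamily_pencilCone hM).system_isOver, ?_⟩
  rw [IsCircularFamily.mem_system, mem_pencilCone]
  -- Openness allows the factor `1 - δ` on `B 0`; as `c > 1 - δ`, the difference is a nonnegative
  -- multiple of `(B 0, 0, 0)`.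
  have h1 : (![c • B 0, B 1, B 2] : Her 3 s) ∈ lrg circularCone s := by
    have := add_mem_lrg_circularCone hδ
      (smul_mem_lrg_circularCone (c := c - (1 - δ)) (by linarith) hB0)
    convert this using 1
    ext1 i
    fin_cases i
    · show c • B 0 = B 0 - δ • B 0 + (c - (1 - δ)) • B 0
      module
    · show B 1 = B 1 - δ • 0 + (c - (1 - δ)) • 0
      module
    · show B 2 = B 2 - δ • 0 + (c - (1 - δ)) • 0
      module
  -- Dividing by `c` moves the scaling from `B` to the Jordan tuple, leaving exactly the pencil at
  -- `B`.
  have h2 := (posSemidef_sum_kronecker_of_mem_lrg_of_mem_sml h1 (jordanTuple_mem_sml n)).smul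
    (inv_nonneg.2 hc0.le)
  convert h2 using 1
  rw [Fin.sum_univ_three, Fin.sum_univ_three, smul_add, smul_add]
  have e0 : (![c • B 0, B 1, B 2] : Her 3 s) 0 = c • B 0 := rfl
  have e1 : (![c • B 0, B 1, B 2] : Her 3 s) 1 = B 1 := rfl
  have e2 : (![c • B 0, B 1, B 2] : Her 3 s) 2 = B 2 := rfl
  rw [e0, e1, e2, jordanTuple_one_val, jordanTuple_two_val, jordanTuple_one_val,
    jordanTuple_two_val, one_smul, one_smul, selfAdjoint.val_smul]
  rw [Matrix.smul_kronecker, inv_smul_smul₀ hc0.ne']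
  simp only [Matrix.kronecker_smul]
  rfl

/-- A tuple in all free numerical ranges over the circular cone lies in the smallest system. -/
theorem mem_sml_of_forall_freeNumericalRange {A : Her 3 s}
    (hA : ∀ W : OperatorSystem 3, W.IsFreeNumericalRange → W.IsOver circularCone → A ∈ W.cone s) :
    A ∈ sml circularCone s := by
  have h : ∀ k : ℕ, ∃ c : ℝ, 1 - 1 / ((k : ℝ) + 1) < c ∧ c ≤ 1 ∧
      scaleTail c A ∈ sml circularCone s := by
    intro k
    obtain ⟨n, c, hc, hc0, hc1, hM⟩ :=
      exists_isCircularTuple_jordanTuple (ε := 1 / ((k : ℝ) + 1)) (by positivity)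
    refine ⟨c, hc, hc1, ?_⟩
    have hAM : A ∈ genCone {(jordanTuple c⁻¹ n : Her 3 n)} s :=
      hA _ (isFreeNumericalRange_genCone hM) (isCircularFamily_genCone hM).system_isOver
    rw [sml_circularCone_eq]
    have hle : genCone {(jordanTuple c⁻¹ n : Her 3 n)} s ≤
        (genCone circularBase s).comap (scaleTail c) := by
      refine genCone_le ?_
      rintro V _ rfl
      show scaleTail c (compress V _) ∈ genCone circularBase s
      -- Shrinking by `c` commutes with compression and undoes the scaling of the generator, which
      -- then lies in the smallest system.
      rw [scaleTail_compress, scaleTail_jordanTuple hc0.ne']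
      refine compress_mem_genCone V ?_
      have := jordanTuple_mem_sml n
      rwa [sml_circularCone_eq] at this
    exact hle hAM
  choose c hc hc1 hmem using h
  have hlim : Tendsto c atTop (𝓝 1) := by
    refine tendsto_of_tendsto_of_tendsto_of_le_of_le ?_ tendsto_const_nhds (fun k => (hc k).le) hc1
    simpa using (tendsto_const_nhds (x := (1 : ℝ))).sub tendsto_one_div_add_atTop_nhds_zero_nat
  have hcont : Continuous fun c : ℝ => scaleTail c A := by
    refine continuous_pi fun i => ?_
    fin_cases i
    · exact continuous_const
    · exact continuous_id.smul continuous_const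
    · exact continuous_id.smul continuous_const
  have hA1 : Tendsto (fun k => scaleTail (c k) A) atTop (𝓝 A) := by
    have := (hcont.tendsto 1).comp hlim
    rwa [scaleTail_one] at this
  exact (isClosed_sml_circularCone s).mem_of_tendsto hA1 (Eventually.of_forall hmem)

end Approximation

/-! ### The exceptional point of the largest system. -/

section CircularPoint

theorem circularPoint_mem_lrg : circularPoint ∈ lrg circularCone 2 := by
  intro v
  let v' : Fin 2 → ℂ := v
  have hq : ∀ a b c : ℝ, (star v ⬝ᵥ ((symm2 a b c).1 *ᵥ v)).re =
      a * ‖v' 0‖ ^ 2 + 2 * b * (star (v' 0) * v' 1).re + c * ‖v' 1‖ ^ 2 := by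
    intro a b c
    show (star v' ⬝ᵥ (!![(a : ℂ), (b : ℂ); (b : ℂ), (c : ℂ)] *ᵥ v')).re = _
    simp [← Complex.normSq_eq_norm_sq, Complex.normSq_apply, Matrix.mulVec, dotProduct, Fin.sum_univ_two]
    ring
  have hb : ((star (v' 0) * v' 1).re) ^ 2 ≤ ‖v' 0‖ ^ 2 * ‖v' 1‖ ^ 2 := by
    have := Complex.abs_re_le_norm (star (v' 0) * v' 1)
    rw [norm_mul, norm_star] at this
    rw [← mul_pow]
    exact sq_le_sq' (by linarith [neg_abs_le (star (v' 0) * v' 1).re]) ((le_abs_self _).trans this)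
  have h0 := hq 1 0 1
  have h1 := hq 0 0 1
  have h2 := hq 0 (1 / √2) 0
  show 0 ≤ (star v ⬝ᵥ ((symm2 1 0 1).1 *ᵥ v)).re ∧ (star v ⬝ᵥ ((symm2 0 0 1).1 *ᵥ v)).re ^ 2 +
    (star v ⬝ᵥ ((symm2 0 (1 / √2) 0).1 *ᵥ v)).re ^ 2 ≤ (star v ⬝ᵥ ((symm2 1 0 1).1 *ᵥ v)).re ^ 2
  rw [h0, h1, h2]
  have hs : (1 / √2) ^ 2 = 1 / 2 := by
    rw [div_pow, Real.sq_sqrt (by norm_num)]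
    norm_num
  refine ⟨by simp; positivity, ?_⟩
  set x := ‖v' 0‖ ^ 2
  set y := ‖v' 1‖ ^ 2
  set z := (star (v' 0) * v' 1).re
  have : (2 * (1 / √2) * z) ^ 2 = 2 * z ^ 2 := by
    rw [mul_pow, mul_pow, hs]
    ring
  have hx : 0 ≤ x := by positivity
  -- The claim is `y² + 2z² ≤ (x + y)²`, where `z² ≤ xy` leaves a slack of `x²`.
  nlinarith [sq_nonneg x]

variable {n : ℕ}

theorem star_dotProduct_mulVec_comm {H : Matrix (Fin n) (Fin n) ℂ} (hH : H.IsHermitian)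
    (v w : Fin n → ℂ) : star w ⬝ᵥ (H *ᵥ v) = star (H *ᵥ w) ⬝ᵥ v := by
  rw [Matrix.star_mulVec, hH.eq, Matrix.dotProduct_mulVec]

/-- A vector annihilated by a diagonal block of a positive semidefinite matrix is annihilated by
the blocks in the same block column. -/
theorem sum_block_mul_eq_zero {K : Matrix (Fin 2 × Fin n) (Fin 2 × Fin n) ℂ} (hK : K.PosSemidef)
    (w : Fin n → ℂ) (hw : ∀ k, ∑ l, K (1, k) (1, l) * w l = 0) (k : Fin n) :
    ∑ l, K (0, k) (1, l) * w l = 0 := by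
  -- The form of `K` vanishes at `w` padded by zero, and a positive semidefinite matrix annihilates
  -- its isotropic vectors.
  set x : Fin 2 × Fin n → ℂ := fun p => if p.1 = 1 then w p.2 else 0 with hx
  have hKx : ∀ i k, (K *ᵥ x) (i, k) = ∑ l, K (i, k) (1, l) * w l := by
    intro i k
    rw [Matrix.mulVec, dotProduct, Fintype.sum_prod_type, Fin.sum_univ_two]
    simp [hx]
  have hzero : star x ⬝ᵥ (K *ᵥ x) = 0 := by
    rw [dotProduct, Fintype.sum_prod_type, Fin.sum_univ_two]
    simp only [hKx, hw]
    simp [hx]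
  rw [hK.dotProduct_mulVec_zero_iff] at hzero
  rw [← hKx, hzero, Pi.zero_apply]

/-- The circular point lies in no free spectrahedron over the circular cone. -/
theorem circularPoint_notMem_freeSpectrahedron {S : OperatorSystem 3} (hS : S.IsFreeSpectrahedron)
    (hO : S.IsOver circularCone) : circularPoint ∉ S.cone 2 := by
  obtain ⟨u, hu, n, M, hM1, hM⟩ := hS
  intro hp
  set Q : (Fin 3 → ℝ) → Matrix (Fin n) (Fin n) ℂ := fun a => ∑ i, a i • (M i).1 with hQ
  have hQD : ∀ a, (Q a).PosSemidef ↔ a ∈ circularCone := fun a => by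
    rw [← hO a, hM, posSemidef_sum_ofVec_kronecker_iff]
  have hQ3 : ∀ a, Q a = a 0 • (M 0).1 + a 1 • (M 1).1 + a 2 • (M 2).1 := fun a =>
    Fin.sum_univ_three _
  have hQu : Q u = 1 := by
    have := congrArg Subtype.val hM1
    rwa [AddSubgroup.val_finsetSum] at this
  have hHer : ∀ i, (M i).1.IsHermitian := fun i => (M i).2
  have hne : Nonempty (Fin n) := by
    by_contra h
    -- An empty pencil would be positive semidefinite everywhere, even at `(-1, 0, 0)`.
    rw [not_nonempty_iff] at h
    have : ![-1, 0, 0] ∈ circularCone := by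
      rw [← hQD]
      have : Q ![-1, 0, 0] = 0 := Subsingleton.elim _ _
      rw [this]
      exact Matrix.PosSemidef.zero
    have := this.1
    simp at this
    linarith
  -- the first matrix is positive definite
  have hM0 : ∀ w : Fin n → ℂ, (star w ⬝ᵥ w).re = 1 → 0 < (star w ⬝ᵥ ((M 0).1 *ᵥ w)).re := by
    intro w hw
    -- Small enough that `(1, 0, 0) - ε u` lies in `D`, whence `M₀ ≥ ε I`.
    set ε : ℝ := 1 / (1 + |u 0| + |u 1| + |u 2|)
    have hε : 0 < ε := by positivity
    have hεm : ε * (1 + |u 0| + |u 1| + |u 2|) = 1 := by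
      simp only [ε]
      field_simp
    have hmem : ![1, 0, 0] - ε • u ∈ circularCone := by
      rw [mem_circularCone_iff]
      intro θ
      have h1 : |u 1 * Real.cos θ| ≤ |u 1| := by
        rw [abs_mul]
        exact mul_le_of_le_one_right (abs_nonneg _) (Real.abs_cos_le_one θ)
      have h2 : |u 2 * Real.sin θ| ≤ |u 2| := by
        rw [abs_mul]
        exact mul_le_of_le_one_right (abs_nonneg _) (Real.abs_sin_le_one θ)
      have h3 : u 0 + u 1 * Real.cos θ + u 2 * Real.sin θ ≤ 1 + |u 0| + |u 1| + |u 2| := by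
        linarith [le_abs_self (u 0), le_abs_self (u 1 * Real.cos θ), le_abs_self (u 2 * Real.sin θ)]
      have := mul_le_mul_of_nonneg_left h3 hε.le
      simp
      linarith
    have h := ((hQD _).2 hmem).re_dotProduct_nonneg w
    have hQe : Q (![1, 0, 0] - ε • u) = (M 0).1 - ε • (1 : Matrix (Fin n) (Fin n) ℂ) := by
      rw [← hQu, hQ3, hQ3]
      simp
      module
    rw [hQe, Matrix.sub_mulVec, Matrix.smul_mulVec, Matrix.one_mulVec, dotProduct_sub,
      dotProduct_smul] at h
    have h4 : RCLike.re (star w ⬝ᵥ (M 0).1 *ᵥ w - ε • (star w ⬝ᵥ w)) =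
        (star w ⬝ᵥ (M 0).1 *ᵥ w).re - ε := by
      simp [hw]
    rw [h4] at h
    linarith
  -- interior points pair strictly positively with boundary points
  have hupos : ∀ θ : ℝ, 0 < u 0 - u 1 * Real.cos θ - u 2 * Real.sin θ := by
    intro θ
    have hev : ∀ᶠ δ : ℝ in 𝓝[>] 0, u - δ • ![1, 0, 0] ∈ circularCone := by
      have hc : Tendsto (fun δ : ℝ => ofVec (u - δ • ![1, 0, 0])) (𝓝 0) (𝓝 (ofVec u)) := by
        have : Continuous fun δ : ℝ => ofVec (u - δ • ![1, 0, 0]) :=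
          continuous_ofVec.comp (by fun_prop)
        simpa using this.tendsto 0
      filter_upwards [(hc.eventually (mem_interior_iff_mem_nhds.1 hu)).filter_mono
        nhdsWithin_le_nhds] with δ hδ
      exact (hO _).1 hδ
    obtain ⟨δ, hδ, hδ0⟩ := (hev.and self_mem_nhdsWithin).exists
    have := mem_circularCone_iff.1 hδ (θ + Real.pi)
    rw [Real.cos_add_pi, Real.sin_add_pi] at this
    simp at this
    linarith
  -- boundary points give singular matrices
  have hker : ∀ θ : ℝ, ∃ v, (star v ⬝ᵥ v).re = 1 ∧ Q ![1, Real.cos θ, Real.sin θ] *ᵥ v = 0 := by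
    intro θ
    set a : Fin 3 → ℝ := ![1, Real.cos θ, Real.sin θ] with ha
    have hpsd : (Q a).PosSemidef := (hQD _).2 (cos_sin_mem_circularCone θ)
    obtain ⟨v, hv, hmin⟩ := Matrix.exists_unit_minimizer (Q a)
    refine ⟨v, hv, ?_⟩
    set m := (star v ⬝ᵥ (Q a *ᵥ v)).re
    have hm0 : 0 ≤ m := hpsd.re_dotProduct_nonneg v
    -- As `Q u = I`, subtracting the smallest eigenvalue `m` of `Q a` amounts to moving from `a` to
    -- `a - m u` inside `D`. Since `a` is on the boundary, pairing with the antipodal ray forces `m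
    -- = 0`.
    have hQm : Q (a - m • u) = Q a - m • (1 : Matrix (Fin n) (Fin n) ℂ) := by
      rw [← hQu, hQ3, hQ3, hQ3]
      simp
      module
    have hpsd' : (Q (a - m • u)).PosSemidef := by
      have hH : (Q a - m • (1 : Matrix (Fin n) (Fin n) ℂ)).IsHermitian :=
        hpsd.1.sub (by simp [Matrix.IsHermitian])
      rw [hQm, hH.posSemidef_iff_re]
      intro w
      have := hmin w
      rw [Matrix.sub_mulVec, Matrix.smul_mulVec, Matrix.one_mulVec, dotProduct_sub,
        dotProduct_smul]
      simpa using this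
    have h1 := mem_circularCone_iff.1 ((hQD _).1 hpsd') (θ + Real.pi)
    rw [Real.cos_add_pi, Real.sin_add_pi] at h1
    simp [ha] at h1
    have hm : m = 0 := by
      have h2 := hupos θ
      have h3 := Real.cos_sq_add_sin_sq θ
      have h4 : m * (u 0 - u 1 * Real.cos θ - u 2 * Real.sin θ) ≤ 0 := by nlinarith
      exact le_antisymm (nonpos_of_mul_nonpos_left h4 h2) hm0
    rw [← hpsd.dotProduct_mulVec_zero_iff]
    apply Complex.ext
    · exact hm
    · exact hpsd.1.im_star_dotProduct_mulVec_self v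
  -- kernel vectors at the point of tangency are annihilated by the last matrix
  have htan : ∀ w, Q ![1, 1, 0] *ᵥ w = 0 → (M 2).1 *ᵥ w = 0 := by
    intro w hw
    obtain ⟨K, hK⟩ : ∃ K : Matrix (Fin 2 × Fin n) (Fin 2 × Fin n) ℂ,
        K = ∑ i, (circularPoint i).1 ⊗ₖ (M i).1 := ⟨_, rfl⟩
    have hKpsd : K.PosSemidef := hK ▸ (hM 2 circularPoint).1 hp
    have hentry : ∀ (i : Fin 2) (k l : Fin n), K (i, k) (1, l) = (symm2 1 0 1).1 i 1 * (M 0).1 k l + (symm2 0 0 1).1 i 1 * (M 1).1 k l +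
          (symm2 0 (1 / √2) 0).1 i 1 * (M 2).1 k l := by
      intro i k l
      rw [hK, Fin.sum_univ_three]
      rfl
    -- The second block column of the pencil at the circular point is `M₂ / √2` above `M₀ + M₁ =
    -- Q(1, 1, 0)`.
    have hblock := sum_block_mul_eq_zero hKpsd w fun k => by
      have h := congrFun hw k
      rw [hQ3] at h
      rw [Finset.sum_congr rfl fun l _ => congrArg (· * w l) (hentry 1 k l)]
      simpa [symm2, Matrix.mulVec, dotProduct] using h
    ext k
    have h0 := hblock k
    rw [Finset.sum_congr rfl fun l _ => congrArg (· * w l) (hentry 0 k l)] at h0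
    have h1 : ((1 / √2 : ℝ) : ℂ) * ((M 2).1 *ᵥ w) k = 0 := by
      rw [Matrix.mulVec, dotProduct, Finset.mul_sum]
      simpa [symm2, mul_assoc] using h0
    have h2 : ((1 / √2 : ℝ) : ℂ) ≠ 0 := by
      have : 0 < 1 / √2 := by positivity
      exact_mod_cast this.ne'
    exact (mul_eq_zero.1 h1).resolve_left h2
  -- pass to a limit of kernel vectors
  choose v hv hQv using fun k : ℕ => hker (1 / ((k : ℝ) + 1))
  obtain ⟨w, hw, φ, hφ, hlim⟩ :=
    Matrix.isCompact_setOf_re_star_dotProduct_self.tendsto_subseq (x := v) hv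
  have hθ : Tendsto (fun k : ℕ => 1 / (((φ k : ℕ) : ℝ) + 1)) atTop (𝓝 0) :=
    tendsto_one_div_add_atTop_nhds_zero_nat.comp hφ.tendsto_atTop
  have hQw : Q ![1, 1, 0] *ᵥ w = 0 := by
    have hc : Continuous fun p : ℝ × (Fin n → ℂ) => Q ![1, Real.cos p.1, Real.sin p.1] *ᵥ p.2 := by
      simp only [hQ3]
      simp only [Matrix.cons_val_zero, Matrix.cons_val_one, Matrix.cons_val, one_smul]
      fun_prop
    have h := (hc.tendsto (0, w)).comp (hθ.prodMk_nhds hlim)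
    have h0 : Tendsto (fun _ : ℕ => (0 : Fin n → ℂ)) atTop (𝓝 (Q ![1, Real.cos 0, Real.sin 0] *ᵥ w)) := by
      refine h.congr fun k => ?_
      exact hQv (φ k)
    have := tendsto_nhds_unique h0 tendsto_const_nhds
    simpa using this
  have hM2w := htan w hQw
  -- `Q(1, cos θ, sin θ)` differs from `Q(1, 1, 0)` by `(cos θ - 1) M₁ + sin θ M₂`, and `w` kills
  -- all terms but the one in `M₁`.
  have hM1v : ∀ k : ℕ, star w ⬝ᵥ ((M 1).1 *ᵥ v k) = 0 := by
    intro k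
    set θ : ℝ := 1 / ((k : ℝ) + 1)
    have hθ0 : 0 < θ := by positivity
    have hθ1 : θ ≤ 1 := by
      rw [div_le_one (by positivity)]
      linarith [(Nat.cast_nonneg k : (0 : ℝ) ≤ k)]
    have hcos : Real.cos θ - 1 ≠ 0 := by
      rw [sub_ne_zero, Ne, Real.cos_eq_one_iff_of_lt_of_lt (by linarith [Real.pi_gt_three])
        (by linarith [Real.pi_gt_three])]
      exact hθ0.ne'
    have h1 : Q ![1, Real.cos θ, Real.sin θ] =
        Q ![1, 1, 0] + (Real.cos θ - 1) • (M 1).1 + Real.sin θ • (M 2).1 := by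
      rw [hQ3, hQ3]
      simp
      module
    have h2 : star w ⬝ᵥ (Q ![1, 1, 0] *ᵥ v k) = 0 := by
      have hH : (Q ![1, 1, 0]).IsHermitian := by
        refine ((hQD _).2 ?_).1
        simp [circularCone]
      rw [star_dotProduct_mulVec_comm hH, hQw]
      simp
    have h3 : star w ⬝ᵥ ((M 2).1 *ᵥ v k) = 0 := by
      rw [star_dotProduct_mulVec_comm (hHer 2), hM2w]
      simp
    have h4 := congrArg (star w ⬝ᵥ ·) (hQv k)
    rw [h1, Matrix.add_mulVec, Matrix.add_mulVec, Matrix.smul_mulVec, Matrix.smul_mulVec,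
      dotProduct_add, dotProduct_add, dotProduct_smul, dotProduct_smul, h2, h3, smul_zero,
      dotProduct_zero] at h4
    rw [zero_add, add_zero] at h4
    exact (smul_eq_zero.1 (h4)).resolve_left hcos
  have hM1w : star w ⬝ᵥ ((M 1).1 *ᵥ w) = 0 := by
    have hc : Continuous fun x : Fin n → ℂ => star w ⬝ᵥ ((M 1).1 *ᵥ x) := by fun_prop
    have h := (hc.tendsto w).comp hlim
    refine (tendsto_nhds_unique (h.congr fun k => ?_) tendsto_const_nhds)
    exact hM1v (φ k)
  have hfin := congrArg (star w ⬝ᵥ ·) hQw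
  have h1 : Q ![1, 1, 0] = (M 0).1 + (M 1).1 := by
    rw [hQ3]
    simp
  rw [h1, Matrix.add_mulVec, dotProduct_add, hM1w, dotProduct_zero, add_zero] at hfin
  have := hM0 w hw
  rw [hfin] at this
  simp at this

end CircularPoint

/-! ### Density of the interior and the failure of finite covers. -/

theorem mem_closure_interior_lrg_circularCone {s : ℕ+} {A : Her 3 s}
    (hA : A ∈ lrg circularCone s) : A ∈ closure (interior (lrg circularCone s)) := by
  obtain ⟨n, c, -, -, -, hM⟩ := exists_isCircularTuple_jordanTuple one_pos
  have hE : lrg circularCone s ∈ 𝓝 (unitTuple s) :=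
    mem_of_superset (sml_circularCone_mem_nhds s) (sml_subset_lrg_of_isCircularTuple hM s)
  -- `A` plus `δ` times a neighbourhood of the unit inside the cone is a neighbourhood of `A + δ •
  -- unitTuple s` inside the cone.
  have hint : ∀ δ : ℝ, 0 < δ → A + δ • unitTuple s ∈ interior (lrg circularCone s) := by
    intro δ hδ
    rw [mem_interior_iff_mem_nhds]
    have hc : Continuous fun B : Her 3 s => δ⁻¹ • (B - A) := by fun_prop
    have h := hc.tendsto (A + δ • unitTuple s)
    rw [add_sub_cancel_left, inv_smul_smul₀ hδ.ne'] at h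
    filter_upwards [h hE] with B hB
    have := add_mem_lrg_circularCone hA (smul_mem_lrg_circularCone hδ.le hB)
    rwa [smul_inv_smul₀ hδ.ne', add_sub_cancel] at this
  have hc : Continuous fun δ : ℝ => A + δ • unitTuple s := by fun_prop
  have hlim : Tendsto (fun δ : ℝ => A + δ • unitTuple s) (𝓝[>] 0) (𝓝 A) := by
    have := (hc.tendsto 0).mono_left (nhdsWithin_le_nhds (s := Set.Ioi 0))
    simpa using this
  refine mem_closure_of_tendsto hlim ?_
  filter_upwards [self_mem_nhdsWithin] with δ hδ
  exact hint δ hδ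

/-- Finitely many free spectrahedra over the circular cone do not cover all of them. -/
theorem not_exists_finite_cover_freeSpectrahedron :
    ¬ ∃ F : Set (OperatorSystem 3), F.Finite ∧
        (∀ T ∈ F, T.IsFreeSpectrahedron ∧ T.IsOver circularCone) ∧
        ∀ S : OperatorSystem 3, S.IsFreeSpectrahedron → S.IsOver circularCone →
          ∀ s : ℕ+, (S.cone s : Set (Her 3 s)) ⊆ ⋃ T ∈ F, (T.cone s : Set (Her 3 s)) := by
  rintro ⟨F, hF, hFS, hcov⟩
  have hclosed : IsClosed (⋃ T ∈ F, (T.cone 2 : Set (Her 3 2))) :=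
    hF.isClosed_biUnion fun T _ => T.isClosed 2
  have hsub : interior (lrg circularCone 2) ⊆ ⋃ T ∈ F, (T.cone 2 : Set (Her 3 2)) := by
    intro B hB
    obtain ⟨S, hS, hO, hBS⟩ := exists_freeSpectrahedron_of_mem_interior_lrg hB
    exact hcov S hS hO 2 hBS
  have hp := closure_minimal hsub hclosed
    (mem_closure_interior_lrg_circularCone circularPoint_mem_lrg)
  simp only [Set.mem_iUnion] at hp
  obtain ⟨T, hT, hTp⟩ := hp
  exact circularPoint_notMem_freeSpectrahedron (hFS T hT).1 (hFS T hT).2 hTp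

theorem mainTheorem2 :
    -- (i)
    ((∀ s : ℕ+, interior (lrg circularCone s) ⊆
        ⋃ S ∈ {S : OperatorSystem 3 | S.IsFreeSpectrahedron ∧ S.IsOver circularCone},
          (S.cone s : Set (Her 3 s))) ∧
      (∀ s : ℕ+, sml circularCone s =
        ⋂ W ∈ {W : OperatorSystem 3 | W.IsFreeNumericalRange ∧ W.IsOver circularCone},
          (W.cone s : Set (Her 3 s)))) ∧
    -- (ii)
    (circularPoint ∈ lrg circularCone 2 ∧
      ∀ S : OperatorSystem 3, S.IsFreeSpectrahedron → S.IsOver circularCone →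
        circularPoint ∉ S.cone 2) ∧
    -- (iii), for containment in a single member and for containment in the levelwise union
    ((¬ ∃ F : Set (OperatorSystem 3), F.Finite ∧
        (∀ T ∈ F, T.IsFreeSpectrahedron ∧ T.IsOver circularCone) ∧
        ∀ S : OperatorSystem 3, S.IsFreeSpectrahedron → S.IsOver circularCone →
          ∃ T ∈ F, S ≤ T) ∧
      (¬ ∃ F : Set (OperatorSystem 3), F.Finite ∧
        (∀ T ∈ F, T.IsFreeSpectrahedron ∧ T.IsOver circularCone) ∧
        ∀ S : OperatorSystem 3, S.IsFreeSpectrahedron → S.IsOver circularCone →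
          ∀ s : ℕ+, (S.cone s : Set (Her 3 s)) ⊆ ⋃ T ∈ F, (T.cone s : Set (Her 3 s)))) := by
  refine ⟨⟨fun s B hB => ?_, fun s => Set.Subset.antisymm ?_ ?_⟩,
    ⟨circularPoint_mem_lrg, fun S hS hO => circularPoint_notMem_freeSpectrahedron hS hO⟩,
    ?_, not_exists_finite_cover_freeSpectrahedron⟩
  · obtain ⟨S, hS, hO, hBS⟩ := exists_freeSpectrahedron_of_mem_interior_lrg hB
    exact Set.mem_biUnion (show S ∈ {S : OperatorSystem 3 | _} from ⟨hS, hO⟩) hBS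
  · exact Set.subset_iInter₂ fun W hW => OperatorSystem.IsOver.sml_subset hW.2 s
  · intro A hA
    exact mem_sml_of_forall_freeNumericalRange fun W hW hO => Set.mem_iInter₂.1 hA W ⟨hW, hO⟩
  · rintro ⟨F, hF, hFS, hcov⟩
    refine not_exists_finite_cover_freeSpectrahedron ⟨F, hF, hFS, fun S hS hO s A hA => ?_⟩
    obtain ⟨T, hT, hST⟩ := hcov S hS hO
    exact Set.mem_biUnion hT (hST s hA)
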